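/- Let $\mathfrak g$ be a finite-dimensional simple complex Lie algebra of type $A_l$ ($l\ge 1$) or $C_l$ ($l\ge 2$), with Cartan subalgebra $\mathfrak h$, Chevalley generators $x_i,y_i,h_i$ ($1\le i\le l$) and Killing form $(\cdot,\cdot)$. Let $A=\mathbb C[t_1^{\pm1},\dots,t_n^{\pm1}]$, let $\Omega_A$ be the free $A$-module on $K_1,\dots,K_n$, let $dA\subset\Omega_A$ be the span of the elements $\sum_{i=1}^n m_it^mK_i$ ($m\in\mathbb Z^n$), and let $\mathcal K_A=\Omega_A/dA$. The toroidal Lie algebra is $$\widetilde{\mathfrak g}_n=(\mathfrak g\otimes A)\oplus\mathcal K_A\oplus D,\qquad D=\bigoplus_{i=1}^n\mathbb C d_i,$$ with brackets, writing $x(a)=x\otimes t^a$, $$[x(a),y(b)]=[x,y](a+b)+(x,y)\sum_{i=1}^n a_it^{a+b}K_i,\quad [d_i,x(a)]=a_ix(a),\quad [d_i,t^aK_j]=a_it^aK_j,$$ $$[d_i,d_j]=0,\quad [\mathfrak g\otimes A,\mathcal K_A]=[\mathcal K_A,\mathcal K_A]=0.$$ Put $\widetilde{\mathfrak h}_n=\mathfrak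 h\oplus D$. For an abelian subalgebra $\mathfrak b$ of a Lie algebra $\mathfrak a$, let $\mathcal M(\mathfrak a,\mathfrak b)$ be the category of $\mathfrak a$-modules whose restriction to $U(\mathfrak b)$ is free of rank one. For $\lambda\in(\mathbb C^*)^n$ and a $\mathfrak g$-module $M$, let $\widetilde M(\lambda,M)$ be the $\widetilde{\mathfrak g}_n$-module with underlying space $M\otimes\mathbb C[d_1,\dots,d_n]$ and action $$x(a)(v\otimes p)=\lambda^a\,(xv)\otimes\tau^a(p),\qquad t^aK_j(v\otimes p)=0,\qquad d_j(v\otimes p)=v\otimes d_jp$$ for $x\in\mathfrak g$, $a\in\mathbb Z^n$, $1\le j\le n$, where $\lambda^a=\lambda_1^{a_1}\cdots\lambda_n^{a_n}$ and $\tau^a(p)(d_1,\dots,d_n)=p(d_1-a_1,\dots,d_n-a_n)$. Theorem. A $\widetilde{\mathfrak g}_n$-module $N$ belongs to $\mathcal M(\widetilde{\mathfrak g}_n,\widetilde{\mathfrak h}_n)$ if and only if $N\cong\widetilde M(\lambda,M_{\mathfrak g})$ for some $\lambda\in(\mathbb C^*)^n$ and some $M_{\mathfrak g}\in\mathcal M(\mathfrak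 g,\mathfrak h)$. -/

import Mathlib

universe u v

open scoped TensorProduct

noncomputable section

/-! ### Modules that are free of rank one over `U(𝔟)` -/

section

attribute [local instance] LieRing.ofAssociativeRing

/-- For a Lie subalgebra `𝔟` of a complex Lie algebra `𝔞`, the restriction to `U(𝔟)` of the
`𝔞`-module `N` is isomorphic to the regular left module `U(𝔟)`. -/
def IsFreeRankOne {𝔞 : Type*} [LieRing 𝔞] [LieAlgebra ℂ 𝔞] (𝔟 : LieSubalgebra ℂ 𝔞)
    (N : Type*) [AddCommGroup N] [Module ℂ N] [LieRingModule 𝔞 N] [LieModule ℂ 𝔞 N] : Prop :=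
  ∃ e : N ≃ₗ[ℂ] UniversalEnvelopingAlgebra ℂ 𝔟,
    ∀ (u : UniversalEnvelopingAlgebra ℂ 𝔟) (v : N),
      e (UniversalEnvelopingAlgebra.lift ℂ ((LieModule.toEnd ℂ 𝔞 N).comp 𝔟.incl) u v) = u * e v

end

namespace Toroidal

/-! ### Laurent polynomials, degree derivations and the space `Ω_A / dA` -/

/-- `A = ℂ[t₁^{±1}, …, tₙ^{±1}]`; the monomial `t^a` is `AddMonoidAlgebra.single a 1`. -/
abbrev Laurent (n : ℕ) : Type := AddMonoidAlgebra ℂ (Fin n → ℤ)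

variable {n : ℕ}

/-- The monomial `t^a`. -/
def mono (a : Fin n → ℤ) : Laurent n := AddMonoidAlgebra.single a 1

/-- The number `∑ᵢ cᵢ aᵢ`. -/
def pairing (c : Fin n → ℂ) (a : Fin n → ℤ) : ℂ := ∑ i, c i * (a i : ℂ)

/-- The derivation `∑ᵢ cᵢ dᵢ`, `dᵢ = tᵢ ∂/∂tᵢ`, of `A`: it maps `t^a` to `(∑ᵢ cᵢ aᵢ) t^a`. -/
def degMap (c : Fin n → ℂ) : Laurent n →ₗ[ℂ] Laurent n :=
  (AddMonoidAlgebra.basis (Fin n → ℤ) ℂ).constr ℂ fun a => pairing c a • mono a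

/-- The free `A`-module `Ω_A = A K₁ ⊕ ⋯ ⊕ A Kₙ`. -/
abbrev Omega (n : ℕ) : Type := Fin n → Laurent n

/-- The element `∑ᵢ mᵢ t^m Kᵢ` of `Ω_A`. -/
def dMono (m : Fin n → ℤ) : Omega n := fun i => (m i : ℂ) • mono m

/-- The subspace `dA` of `Ω_A`. -/
def exactForms (n : ℕ) : Submodule ℂ (Omega n) :=
  Submodule.span ℂ (Set.range (dMono (n := n)))

/-- `𝒦_A = Ω_A / dA`. -/
abbrev KA (n : ℕ) : Type := Omega n ⧸ exactForms n

/-- The class of `t^a Kⱼ` in `𝒦_A`. -/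
def tK (a : Fin n → ℤ) (j : Fin n) : KA n :=
  (exactForms n).mkQ (Pi.single j (mono a))

lemma mono_eq_basis (a : Fin n → ℤ) : mono a = AddMonoidAlgebra.basis (Fin n → ℤ) ℂ a := rfl

@[simp] lemma degMap_mono (c : Fin n → ℂ) (a : Fin n → ℤ) :
    degMap c (mono a) = pairing c a • mono a := by
  rw [degMap, mono_eq_basis, Module.Basis.constr_basis, mono_eq_basis]

lemma pairing_add (c : Fin n → ℂ) (a b : Fin n → ℤ) :
    pairing c (a + b) = pairing c a + pairing c b := by
  simp [pairing, mul_add, Finset.sum_add_distrib]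

lemma pairing_single (i : Fin n) (a : Fin n → ℤ) :
    pairing (Pi.single i 1) a = (a i : ℂ) := by
  classical
  simp [pairing, Pi.single_apply]

lemma pairing_add_left (c c' : Fin n → ℂ) (a : Fin n → ℤ) :
    pairing (c + c') a = pairing c a + pairing c' a := by
  simp [pairing, add_mul, Finset.sum_add_distrib]

lemma pairing_smul_left (r : ℂ) (c : Fin n → ℂ) (a : Fin n → ℤ) :
    pairing (r • c) a = r * pairing c a := by
  simp [pairing, Finset.mul_sum, mul_assoc]

lemma pairing_zero_right (c : Fin n → ℂ) : pairing c (0 : Fin n → ℤ) = 0 := by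
  simp [pairing]

lemma laurent_hom_ext {V : Type*} [AddCommMonoid V] [Module ℂ V] {f g : Laurent n →ₗ[ℂ] V}
    (h : ∀ a, f (mono a) = g (mono a)) : f = g :=
  (AddMonoidAlgebra.basis (Fin n → ℤ) ℂ).ext h

lemma mono_mul (a b : Fin n → ℤ) : mono a * mono b = mono (a + b) := by
  simp [mono, AddMonoidAlgebra.single_mul_single]

lemma degMap_mul (c : Fin n → ℂ) (f g : Laurent n) :
    degMap c (f * g) = degMap c f * g + f * degMap c g := by
  have : (LinearMap.mul ℂ (Laurent n)).compr₂ (degMap c)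
      = (LinearMap.mul ℂ (Laurent n)).comp (degMap c)
        + (LinearMap.mul ℂ (Laurent n)).compl₂ (degMap c) := by
    refine laurent_hom_ext fun a => laurent_hom_ext fun b => ?_
    simp only [LinearMap.compr₂_apply, LinearMap.mul_apply', LinearMap.add_apply,
      LinearMap.comp_apply, LinearMap.compl₂_apply, degMap_mono, mono_mul, pairing_add,
      smul_mul_assoc, mul_smul_comm, add_smul]
  simpa using LinearMap.congr_fun₂ this f g

lemma degMap_comm (c c' : Fin n → ℂ) (f : Laurent n) :
    degMap c (degMap c' f) = degMap c' (degMap c f) := by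
  have : (degMap c).comp (degMap c') = (degMap c').comp (degMap c) := by
    refine laurent_hom_ext fun a => ?_
    simp [smul_smul, mul_comm]
  exact LinearMap.congr_fun this f

lemma degMap_add (c c' : Fin n → ℂ) : degMap (c + c') = degMap c + degMap c' := by
  refine laurent_hom_ext fun a => ?_
  simp [pairing_add_left, add_smul]

lemma degMap_smul (r : ℂ) (c : Fin n → ℂ) : degMap (r • c) = r • degMap c := by
  refine laurent_hom_ext fun a => ?_
  simp [pairing_smul_left, mul_smul]

/-- `c ↦ degMap c` as a linear map. -/
def degLin (n : ℕ) : (Fin n → ℂ) →ₗ[ℂ] Laurent n →ₗ[ℂ] Laurent n where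
  toFun := degMap
  map_add' := degMap_add
  map_smul' := degMap_smul

/-- `df = ∑ᵢ (dᵢ f) Kᵢ`, so that `d(t^m) = ∑ᵢ mᵢ t^m Kᵢ`. -/
def dForm (n : ℕ) : Laurent n →ₗ[ℂ] Omega n :=
  LinearMap.pi fun i => degMap (Pi.single i 1)

lemma dForm_mono (a : Fin n → ℤ) : dForm n (mono a) = dMono a := by
  funext i
  simp [dForm, dMono, pairing_single]

lemma dForm_mem (f : Laurent n) : dForm n f ∈ exactForms n := by
  have : (exactForms n).mkQ.comp (dForm n) = 0 := by
    refine laurent_hom_ext fun a => ?_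
    rw [LinearMap.comp_apply, dForm_mono, LinearMap.zero_apply, Submodule.mkQ_apply,
      Submodule.Quotient.mk_eq_zero]
    exact Submodule.subset_span ⟨a, rfl⟩
  rw [← Submodule.Quotient.mk_eq_zero]
  exact LinearMap.congr_fun this f

/-- The componentwise action of `∑ᵢ cᵢ dᵢ` on `Ω_A` (each `Kⱼ` has degree `0`). -/
def degOmega (c : Fin n → ℂ) : Omega n →ₗ[ℂ] Omega n :=
  LinearMap.pi fun i => (degMap c).comp (LinearMap.proj i)

lemma degOmega_dMono (c : Fin n → ℂ) (m : Fin n → ℤ) :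
    degOmega c (dMono m) = pairing c m • dMono m := by
  funext i
  simp [degOmega, dMono, smul_smul, mul_comm]

lemma degOmega_mem (c : Fin n → ℂ) :
    exactForms n ≤ (exactForms n).comap (degOmega c) := by
  refine Submodule.span_le.2 ?_
  rintro _ ⟨m, rfl⟩
  change degOmega c (dMono m) ∈ exactForms n
  rw [degOmega_dMono]
  exact Submodule.smul_mem _ _ (Submodule.subset_span ⟨m, rfl⟩)

/-- The action of `∑ᵢ cᵢ dᵢ` on `𝒦_A`: it maps `t^a Kⱼ` to `(∑ᵢ cᵢ aᵢ) t^a Kⱼ`. -/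
def degK (c : Fin n → ℂ) : KA n →ₗ[ℂ] KA n :=
  (exactForms n).mapQ (exactForms n) (degOmega c) (degOmega_mem c)

@[simp] lemma degK_mkQ (c : Fin n → ℂ) (w : Omega n) :
    degK c ((exactForms n).mkQ w) = (exactForms n).mkQ (degOmega c w) := rfl

lemma degK_add (c c' : Fin n → ℂ) : degK (c + c') = degK c + degK c' := by
  refine LinearMap.ext fun k => ?_
  obtain ⟨w, rfl⟩ := (exactForms n).mkQ_surjective k
  simp only [degK_mkQ, LinearMap.add_apply, ← map_add]
  congr 1
  funext i
  simp [degOmega, degMap_add]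

lemma degK_smul (r : ℂ) (c : Fin n → ℂ) : degK (r • c) = r • degK c := by
  refine LinearMap.ext fun k => ?_
  obtain ⟨w, rfl⟩ := (exactForms n).mkQ_surjective k
  simp only [degK_mkQ, LinearMap.smul_apply, ← map_smul]
  congr 1
  funext i
  simp [degOmega, degMap_smul]

lemma degK_comm (c c' : Fin n → ℂ) (k : KA n) :
    degK c (degK c' k) = degK c' (degK c k) := by
  obtain ⟨w, rfl⟩ := (exactForms n).mkQ_surjective k
  exact congrArg (exactForms n).mkQ (funext fun i => degMap_comm c c' (w i))

lemma degK_tK (c : Fin n → ℂ) (a : Fin n → ℤ) (j : Fin n) :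
    degK c (tK a j) = pairing c a • tK a j := by
  classical
  rw [tK, degK_mkQ, ← map_smul]
  congr 1
  funext i
  by_cases h : i = j
  · subst h; simp [degOmega]
  · simp [degOmega, Pi.single_eq_of_ne h]

/-- The class in `𝒦_A` of `(df) g = ∑ᵢ (dᵢ f) g Kᵢ`. -/
def formPair (n : ℕ) : Laurent n →ₗ[ℂ] Laurent n →ₗ[ℂ] KA n :=
  LinearMap.mk₂ ℂ (fun f g => (exactForms n).mkQ fun i => dForm n f i * g)
    (fun f f' g => by
      rw [← map_add]; congr 1; funext i; simp [add_mul])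
    (fun r f g => by
      rw [← map_smul]; congr 1; funext i; simp)
    (fun f g g' => by
      rw [← map_add]; congr 1; funext i; simp [mul_add])
    (fun r f g => by
      rw [← map_smul]; congr 1; funext i; simp)

lemma formPair_apply (f g : Laurent n) :
    formPair n f g = (exactForms n).mkQ fun i => dForm n f i * g := rfl

lemma formPair_mono (a b : Fin n → ℤ) :
    formPair n (mono a) (mono b) = ∑ i, (a i : ℂ) • tK (a + b) i := by
  classical
  simp only [formPair_apply, tK, dForm_mono, ← map_smul, ← map_sum]
  congr 1
  funext i
  simp only [dMono, smul_mul_assoc, mono_mul, Finset.sum_apply, Pi.smul_apply, Pi.single_apply]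
  simp

lemma formPair_add_swap (f g : Laurent n) : formPair n f g + formPair n g f = 0 := by
  have : formPair n f g + formPair n g f = (exactForms n).mkQ (dForm n (f * g)) := by
    rw [formPair_apply, formPair_apply, ← map_add]
    congr 1
    funext i
    simp [dForm, degMap_mul, mul_comm]
  rw [this, Submodule.mkQ_apply, Submodule.Quotient.mk_eq_zero]
  exact dForm_mem _

lemma formPair_mul (f g h : Laurent n) :
    formPair n f (g * h) + formPair n g (h * f) + formPair n h (f * g) = 0 := by
  have : formPair n f (g * h) + formPair n g (h * f) + formPair n h (f * g)
      = (exactForms n).mkQ (dForm n (f * g * h)) := by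
    rw [formPair_apply, formPair_apply, formPair_apply, ← map_add, ← map_add]
    congr 1
    funext i
    simp only [dForm, LinearMap.pi_apply, Pi.add_apply, degMap_mul]
    ring
  rw [this, Submodule.mkQ_apply, Submodule.Quotient.mk_eq_zero]
  exact dForm_mem _

lemma degK_formPair (c : Fin n → ℂ) (f g : Laurent n) :
    degK c (formPair n f g) = formPair n (degMap c f) g + formPair n f (degMap c g) := by
  rw [formPair_apply, formPair_apply, formPair_apply, degK_mkQ, ← map_add]
  congr 1
  funext i
  simp [degOmega, dForm, degMap_mul, degMap_comm c]

/-! ### The toroidal Lie algebra -/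

section algebra

variable (𝔤 : Type*) [LieRing 𝔤] [LieAlgebra ℂ 𝔤]

/-- The space `A ⊗ 𝔤` of the loop algebra. -/
abbrev Loop (n : ℕ) : Type _ := Laurent n ⊗[ℂ] 𝔤

variable {𝔤}

/-- The element `x(a) = x ⊗ t^a` of the loop algebra. -/
def loopElt (x : 𝔤) (a : Fin n → ℤ) : Loop 𝔤 n := mono a ⊗ₜ[ℂ] x

/-- The bracket of the loop algebra: `(f ⊗ x, g ⊗ y) ↦ fg ⊗ ⁅x, y⁆`. -/
def loopLie (𝔤 : Type*) [LieRing 𝔤] [LieAlgebra ℂ 𝔤] (n : ℕ) :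
    Loop 𝔤 n →ₗ[ℂ] Loop 𝔤 n →ₗ[ℂ] Loop 𝔤 n :=
  TensorProduct.curry <|
    TensorProduct.map (LinearMap.mul' ℂ (Laurent n))
        (LieModule.toModuleHom ℂ 𝔤 𝔤 : 𝔤 ⊗[ℂ] 𝔤 →ₗ[ℂ] 𝔤) ∘ₗ
      (TensorProduct.tensorTensorTensorComm ℂ (Laurent n) 𝔤 (Laurent n) 𝔤).toLinearMap

@[simp] lemma loopLie_tmul (f g : Laurent n) (x y : 𝔤) :
    loopLie 𝔤 n (f ⊗ₜ[ℂ] x) (g ⊗ₜ[ℂ] y) = (f * g) ⊗ₜ[ℂ] ⁅x, y⁆ := rfl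

lemma loopLie_add_swap (u v : Loop 𝔤 n) : loopLie 𝔤 n u v + loopLie 𝔤 n v u = 0 := by
  induction u using TensorProduct.induction_on with
  | zero => simp
  | add u u' hu hu' =>
    simp only [map_add, LinearMap.add_apply]
    rw [add_add_add_comm, hu, hu', add_zero]
  | tmul f x =>
    induction v using TensorProduct.induction_on with
    | zero => simp
    | add v v' hv hv' =>
      simp only [map_add, LinearMap.add_apply]
      rw [add_add_add_comm, hv, hv', add_zero]
    | tmul g y =>
      rw [loopLie_tmul, loopLie_tmul, mul_comm g f, ← TensorProduct.tmul_add,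
        ← lie_skew x y, neg_add_cancel, TensorProduct.tmul_zero]

lemma loopLie_skew (u v : Loop 𝔤 n) : loopLie 𝔤 n u v = -loopLie 𝔤 n v u :=
  eq_neg_of_add_eq_zero_left (loopLie_add_swap u v)

lemma loopLie_self (u : Loop 𝔤 n) : loopLie 𝔤 n u u = 0 := by
  have h := loopLie_add_swap u u
  rw [← two_smul ℂ] at h
  exact (smul_eq_zero.1 h).resolve_left two_ne_zero

lemma loopLie_leibniz (u v w : Loop 𝔤 n) :
    loopLie 𝔤 n u (loopLie 𝔤 n v w)
      = loopLie 𝔤 n (loopLie 𝔤 n u v) w + loopLie 𝔤 n v (loopLie 𝔤 n u w) := by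
  induction u using TensorProduct.induction_on with
  | zero => simp
  | add u u' hu hu' => simp only [map_add, LinearMap.add_apply, hu, hu']; abel
  | tmul f x =>
    induction v using TensorProduct.induction_on with
    | zero => simp
    | add v v' hv hv' => simp only [map_add, LinearMap.add_apply, hv, hv']; abel
    | tmul g y =>
      induction w using TensorProduct.induction_on with
      | zero => simp
      | add w w' hw hw' => simp only [map_add, hw, hw']; abel
      | tmul h z =>
        simp only [loopLie_tmul]
        rw [mul_left_comm g f h, ← mul_assoc, leibniz_lie x y z, TensorProduct.tmul_add]

/-- The action of `∑ᵢ cᵢ dᵢ` on the loop algebra: it maps `x(a)` to `(∑ᵢ cᵢ aᵢ) x(a)`. -/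
def degLoop (c : Fin n → ℂ) : Loop 𝔤 n →ₗ[ℂ] Loop 𝔤 n := (degMap c).rTensor 𝔤

@[simp] lemma degLoop_tmul (c : Fin n → ℂ) (f : Laurent n) (x : 𝔤) :
    degLoop c (f ⊗ₜ[ℂ] x : Loop 𝔤 n) = degMap c f ⊗ₜ[ℂ] x := rfl

lemma degLoop_add (c c' : Fin n → ℂ) :
    (degLoop (c + c') : Loop 𝔤 n →ₗ[ℂ] Loop 𝔤 n) = degLoop c + degLoop c' := by
  simp [degLoop, degMap_add, LinearMap.rTensor_add]

lemma degLoop_smul (r : ℂ) (c : Fin n → ℂ) :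
    (degLoop (r • c) : Loop 𝔤 n →ₗ[ℂ] Loop 𝔤 n) = r • degLoop c := by
  simp [degLoop, degMap_smul, LinearMap.rTensor_smul]

lemma degLoop_comm (c c' : Fin n → ℂ) (u : Loop 𝔤 n) :
    degLoop c (degLoop c' u) = degLoop c' (degLoop c u) := by
  induction u using TensorProduct.induction_on with
  | zero => simp
  | tmul f x => simp [degMap_comm c c']
  | add u v hu hv => simp only [map_add, hu, hv]

lemma degLoop_lie (c : Fin n → ℂ) (u v : Loop 𝔤 n) :
    degLoop c (loopLie 𝔤 n u v) = loopLie 𝔤 n (degLoop c u) v + loopLie 𝔤 n u (degLoop c v) := by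
  induction u using TensorProduct.induction_on with
  | zero => simp
  | add u u' hu hu' => simp only [map_add, LinearMap.add_apply, hu, hu']; abel
  | tmul f x =>
    induction v using TensorProduct.induction_on with
    | zero => simp
    | add v v' hv hv' => simp only [map_add, hv, hv']; abel
    | tmul g y => simp [degMap_mul, TensorProduct.add_tmul]

/-- The cocycle `(f ⊗ x, g ⊗ y) ↦ (x, y) · [(df) g]`, with `(x, y)` the Killing form. -/
def cocycle (𝔤 : Type*) [LieRing 𝔤] [LieAlgebra ℂ 𝔤] (n : ℕ) :
    Loop 𝔤 n →ₗ[ℂ] Loop 𝔤 n →ₗ[ℂ] KA n :=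
  TensorProduct.curry <|
    TensorProduct.lift (LinearMap.lsmul ℂ (KA n)).flip ∘ₗ
      TensorProduct.map (TensorProduct.lift (formPair n)) (TensorProduct.lift (killingForm ℂ 𝔤)) ∘ₗ
        (TensorProduct.tensorTensorTensorComm ℂ (Laurent n) 𝔤 (Laurent n) 𝔤).toLinearMap

@[simp] lemma cocycle_tmul (f g : Laurent n) (x y : 𝔤) :
    cocycle 𝔤 n (f ⊗ₜ[ℂ] x) (g ⊗ₜ[ℂ] y) = killingForm ℂ 𝔤 x y • formPair n f g := rfl

lemma cocycle_add_swap (u v : Loop 𝔤 n) : cocycle 𝔤 n u v + cocycle 𝔤 n v u = 0 := by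
  induction u using TensorProduct.induction_on with
  | zero => simp
  | add u u' hu hu' =>
    simp only [map_add, LinearMap.add_apply]
    rw [add_add_add_comm, hu, hu', add_zero]
  | tmul f x =>
    induction v using TensorProduct.induction_on with
    | zero => simp
    | add v v' hv hv' =>
      simp only [map_add, LinearMap.add_apply]
      rw [add_add_add_comm, hv, hv', add_zero]
    | tmul g y =>
      rw [cocycle_tmul, cocycle_tmul, LieModule.traceForm_comm ℂ 𝔤 𝔤 y x, ← smul_add,
        formPair_add_swap, smul_zero]

lemma cocycle_self (u : Loop 𝔤 n) : cocycle 𝔤 n u u = 0 := by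
  have h := cocycle_add_swap u u
  rw [← two_smul ℂ] at h
  exact (smul_eq_zero.1 h).resolve_left two_ne_zero

lemma cocycle_jacobi (u v w : Loop 𝔤 n) :
    cocycle 𝔤 n u (loopLie 𝔤 n v w) + cocycle 𝔤 n v (loopLie 𝔤 n w u) + cocycle 𝔤 n w (loopLie 𝔤 n u v) = 0 := by
  have add_aux : ∀ a b c a' b' c' : KA n, a + b + c = 0 → a' + b' + c' = 0 →
      (a + a') + (b + b') + (c + c') = 0 := by
    intro a b c a' b' c' h h'
    have : (a + a') + (b + b') + (c + c') = (a + b + c) + (a' + b' + c') := by abel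
    rw [this, h, h', add_zero]
  induction u using TensorProduct.induction_on with
  | zero => simp
  | add u u' hu hu' =>
    simp only [map_add, LinearMap.add_apply]
    exact add_aux _ _ _ _ _ _ hu hu'
  | tmul f x =>
    induction v using TensorProduct.induction_on with
    | zero => simp
    | add v v' hv hv' =>
      simp only [map_add, LinearMap.add_apply]
      exact add_aux _ _ _ _ _ _ hv hv'
    | tmul g y =>
      induction w using TensorProduct.induction_on with
      | zero => simp
      | add w w' hw hw' =>
        simp only [map_add, LinearMap.add_apply]
        exact add_aux _ _ _ _ _ _ hw hw'
      | tmul h z =>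
        simp only [loopLie_tmul, cocycle_tmul]
        have h1 : killingForm ℂ 𝔤 y ⁅z, x⁆ = killingForm ℂ 𝔤 x ⁅y, z⁆ := by
          rw [← LieModule.traceForm_apply_lie_apply ℂ 𝔤 𝔤 y z x,
            LieModule.traceForm_comm ℂ 𝔤 𝔤 ⁅y, z⁆ x]
        have h2 : killingForm ℂ 𝔤 z ⁅x, y⁆ = killingForm ℂ 𝔤 x ⁅y, z⁆ := by
          rw [LieModule.traceForm_comm ℂ 𝔤 𝔤 z ⁅x, y⁆,
            LieModule.traceForm_apply_lie_apply ℂ 𝔤 𝔤 x y z]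
        rw [h1, h2, ← smul_add, ← smul_add, formPair_mul, smul_zero]

lemma degK_cocycle (c : Fin n → ℂ) (u v : Loop 𝔤 n) :
    degK c (cocycle 𝔤 n u v) = cocycle 𝔤 n (degLoop c u) v + cocycle 𝔤 n u (degLoop c v) := by
  induction u using TensorProduct.induction_on with
  | zero => simp
  | add u u' hu hu' => simp only [map_add, LinearMap.add_apply, hu, hu']; abel
  | tmul f x =>
    induction v using TensorProduct.induction_on with
    | zero => simp
    | add v v' hv hv' => simp only [map_add, hv, hv']; abel
    | tmul g y => simp [degK_formPair, smul_add]

end algebra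

end Toroidal

open Toroidal

/-- The toroidal Lie algebra `𝔤̃ₙ = (A ⊗ 𝔤) ⊕ 𝒦_A ⊕ D`, as a vector space. The last component
`c` stands for `∑ᵢ cᵢ dᵢ ∈ D`. -/
@[ext] structure ToroidalAlgebra (n : ℕ) (𝔤 : Type*) [LieRing 𝔤] [LieAlgebra ℂ 𝔤] where
  /-- the component in the loop algebra -/
  loop : Loop 𝔤 n
  /-- the central component -/
  cent : KA n
  /-- the component in `D` -/
  deg : Fin n → ℂ

namespace ToroidalAlgebra

variable {n : ℕ} {𝔤 : Type*} [LieRing 𝔤] [LieAlgebra ℂ 𝔤]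

/-- The underlying set is a product. -/
def equivProd : ToroidalAlgebra n 𝔤 ≃ Loop 𝔤 n × KA n × (Fin n → ℂ) where
  toFun u := (u.loop, u.cent, u.deg)
  invFun p := ⟨p.1, p.2.1, p.2.2⟩
  left_inv _ := rfl
  right_inv _ := rfl

instance : AddCommGroup (ToroidalAlgebra n 𝔤) := equivProd.addCommGroup
instance : Module ℂ (ToroidalAlgebra n 𝔤) := equivProd.module ℂ

@[simp] lemma loop_add (u v : ToroidalAlgebra n 𝔤) : (u + v).loop = u.loop + v.loop := rfl
@[simp] lemma cent_add (u v : ToroidalAlgebra n 𝔤) : (u + v).cent = u.cent + v.cent := rfl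
@[simp] lemma deg_add (u v : ToroidalAlgebra n 𝔤) : (u + v).deg = u.deg + v.deg := rfl
@[simp] lemma loop_zero : (0 : ToroidalAlgebra n 𝔤).loop = 0 := rfl
@[simp] lemma cent_zero : (0 : ToroidalAlgebra n 𝔤).cent = 0 := rfl
@[simp] lemma deg_zero : (0 : ToroidalAlgebra n 𝔤).deg = 0 := rfl
@[simp] lemma loop_smul (r : ℂ) (u : ToroidalAlgebra n 𝔤) : (r • u).loop = r • u.loop := rfl
@[simp] lemma cent_smul (r : ℂ) (u : ToroidalAlgebra n 𝔤) : (r • u).cent = r • u.cent := rfl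
@[simp] lemma deg_smul (r : ℂ) (u : ToroidalAlgebra n 𝔤) : (r • u).deg = r • u.deg := rfl

/-- `⁅x(a), y(b)⁆ = ⁅x, y⁆(a+b) + (x, y) ∑ᵢ aᵢ t^{a+b} Kᵢ`, `𝒦_A` commutes with the loop algebra
and with itself, `D` is abelian and acts on the loop algebra and on `𝒦_A` by the degree. -/
instance : Bracket (ToroidalAlgebra n 𝔤) (ToroidalAlgebra n 𝔤) where
  bracket u v :=
    ⟨loopLie 𝔤 n u.loop v.loop + degLoop u.deg v.loop - degLoop v.deg u.loop,
      cocycle 𝔤 n u.loop v.loop + degK u.deg v.cent - degK v.deg u.cent, 0⟩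

@[simp] lemma loop_lie (u v : ToroidalAlgebra n 𝔤) :
    ⁅u, v⁆.loop = loopLie 𝔤 n u.loop v.loop + degLoop u.deg v.loop - degLoop v.deg u.loop := rfl
@[simp] lemma cent_lie (u v : ToroidalAlgebra n 𝔤) :
    ⁅u, v⁆.cent = cocycle 𝔤 n u.loop v.loop + degK u.deg v.cent - degK v.deg u.cent := rfl
@[simp] lemma deg_lie (u v : ToroidalAlgebra n 𝔤) : ⁅u, v⁆.deg = 0 := rfl

lemma degLoop_zero : (degLoop (0 : Fin n → ℂ) : Loop 𝔤 n →ₗ[ℂ] Loop 𝔤 n) = 0 := by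
  simpa using degLoop_smul (𝔤 := 𝔤) (0 : ℂ) (0 : Fin n → ℂ)

lemma degK_zero : (degK (0 : Fin n → ℂ)) = 0 := by
  simpa using degK_smul (0 : ℂ) (0 : Fin n → ℂ)

instance : LieRing (ToroidalAlgebra n 𝔤) where
  add_lie u v w := by
    ext1
    · simp only [loop_lie, loop_add, deg_add, degLoop_add, map_add, LinearMap.add_apply]
      abel
    · simp only [cent_lie, loop_add, cent_add, deg_add, degK_add, map_add, LinearMap.add_apply]
      abel
    · simp
  lie_add u v w := by
    ext1
    · simp only [loop_lie, loop_add, deg_add, degLoop_add, map_add, LinearMap.add_apply]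
      abel
    · simp only [cent_lie, loop_add, cent_add, deg_add, degK_add, map_add, LinearMap.add_apply]
      abel
    · simp
  lie_self u := by
    ext1
    · simp [loopLie_self]
    · simp [cocycle_self]
    · simp
  leibniz_lie u v w := by
    ext1
    · simp only [loop_lie, loop_add, deg_lie, degLoop_zero, LinearMap.zero_apply, map_add,
        map_sub, LinearMap.add_apply, LinearMap.sub_apply, degLoop_lie]
      rw [loopLie_leibniz u.loop v.loop w.loop, degLoop_comm u.deg v.deg, degLoop_comm u.deg w.deg,
        degLoop_comm v.deg w.deg, loopLie_skew v.loop (degLoop w.deg u.loop)]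
      abel
    · simp only [cent_lie, cent_add, loop_lie, deg_lie, degK_zero, LinearMap.zero_apply, map_add,
        map_sub, LinearMap.add_apply, LinearMap.sub_apply, degK_cocycle]
      have h := cocycle_jacobi u.loop v.loop w.loop
      rw [loopLie_skew w.loop u.loop, map_neg,
        eq_neg_of_add_eq_zero_left (cocycle_add_swap w.loop (loopLie 𝔤 n u.loop v.loop))] at h
      have h' : cocycle 𝔤 n u.loop (loopLie 𝔤 n v.loop w.loop)
          = cocycle 𝔤 n v.loop (loopLie 𝔤 n u.loop w.loop) + cocycle 𝔤 n (loopLie 𝔤 n u.loop v.loop) w.loop := by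
        rw [← sub_eq_zero, ← h]; abel
      rw [h', degK_comm u.deg v.deg, degK_comm u.deg w.deg, degK_comm v.deg w.deg,
        eq_neg_of_add_eq_zero_left (cocycle_add_swap v.loop (degLoop w.deg u.loop))]
      abel
    · simp

instance : LieAlgebra ℂ (ToroidalAlgebra n 𝔤) where
  lie_smul r u v := by
    ext1
    · simp only [loop_lie, loop_smul, deg_smul, degLoop_smul, map_smul,
        LinearMap.smul_apply, smul_add, smul_sub]
    · simp only [cent_lie, loop_smul, cent_smul, deg_smul, degK_smul, map_smul,
        LinearMap.smul_apply, smul_add, smul_sub]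
    · simp

/-- The element `x(a) = x ⊗ t^a`. -/
def elt (x : 𝔤) (a : Fin n → ℤ) : ToroidalAlgebra n 𝔤 := ⟨loopElt x a, 0, 0⟩

/-- The central element `t^a Kⱼ`. -/
def central (a : Fin n → ℤ) (j : Fin n) : ToroidalAlgebra n 𝔤 := ⟨0, tK a j, 0⟩

/-- The derivation `dᵢ`. -/
def der (i : Fin n) : ToroidalAlgebra n 𝔤 := ⟨0, 0, Pi.single i 1⟩

lemma elt_lie_elt (x y : 𝔤) (a b : Fin n → ℤ) :
    ⁅(elt x a : ToroidalAlgebra n 𝔤), elt y b⁆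
      = elt ⁅x, y⁆ (a + b) + killingForm ℂ 𝔤 x y • ∑ i, (a i : ℂ) • central (a + b) i := by
  have hs : ∀ (s : Finset (Fin n)) (z : Fin n → ToroidalAlgebra n 𝔤),
      (∑ i ∈ s, z i).loop = ∑ i ∈ s, (z i).loop ∧ (∑ i ∈ s, z i).cent = ∑ i ∈ s, (z i).cent ∧
        (∑ i ∈ s, z i).deg = ∑ i ∈ s, (z i).deg := by
    classical
    intro s z
    induction s using Finset.induction_on with
    | empty => simp
    | insert i s hi ih => simp [Finset.sum_insert hi, ih]
  ext1
  · simp [elt, central, loopElt, hs, degLoop_zero, mono_mul]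
  · simp [elt, central, loopElt, hs, degK_zero, formPair_mono]
  · simp [elt, central, hs]

lemma der_lie_elt (i : Fin n) (x : 𝔤) (a : Fin n → ℤ) :
    ⁅(der i : ToroidalAlgebra n 𝔤), elt x a⁆ = (a i : ℂ) • elt x a := by
  ext1
  · simp [der, elt, loopElt, degLoop_zero, pairing_single, TensorProduct.smul_tmul']
  · simp [der, elt]
  · simp [der, elt]

lemma der_lie_central (i : Fin n) (a : Fin n → ℤ) (j : Fin n) :
    ⁅(der i : ToroidalAlgebra n 𝔤), (central a j : ToroidalAlgebra n 𝔤)⁆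
      = (a i : ℂ) • central a j := by
  ext1
  · simp [der, central]
  · simp [der, central, degK_tK, pairing_single]
  · simp [der, central]

/-- The Cartan subalgebra `𝔥̃ₙ = 𝔥 ⊕ D` of `𝔤̃ₙ`, with `𝔥` embedded as `𝔥 ⊗ 1`. -/
def cartan (n : ℕ) (𝔥 : LieSubalgebra ℂ 𝔤) : LieSubalgebra ℂ (ToroidalAlgebra n 𝔤) where
  carrier := {u | (∃ h ∈ 𝔥, u.loop = loopElt h 0) ∧ u.cent = 0}
  zero_mem' := ⟨⟨0, 𝔥.zero_mem, by simp [loopElt]⟩, rfl⟩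
  add_mem' := by
    rintro u v ⟨⟨h, hh, hu⟩, hu'⟩ ⟨⟨k, hk, hv⟩, hv'⟩
    exact ⟨⟨h + k, 𝔥.add_mem hh hk, by simp [hu, hv, loopElt, TensorProduct.tmul_add]⟩,
      by simp [hu', hv']⟩
  smul_mem' := by
    rintro r u ⟨⟨h, hh, hu⟩, hu'⟩
    exact ⟨⟨r • h, 𝔥.smul_mem r hh, by simp [hu, loopElt]⟩, by simp [hu']⟩
  lie_mem' := by
    rintro u v ⟨⟨h, hh, hu⟩, hu'⟩ ⟨⟨k, hk, hv⟩, hv'⟩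
    refine ⟨⟨⁅h, k⁆, 𝔥.lie_mem hh hk, ?_⟩, ?_⟩
    · simp [hu, hv, loopElt, pairing_zero_right, mono_mul]
    · simp [hu, hv, hu', hv', loopElt, formPair_mono]

end ToroidalAlgebra

/-! ### The modules `M̃(λ, M)` -/

namespace Toroidal

variable {n : ℕ}

/-- The polynomial algebra `𝒫_D = ℂ[d₁, …, dₙ]`. -/
abbrev PD (n : ℕ) : Type := MvPolynomial (Fin n) ℂ

/-- The shift `τ^a`: the algebra endomorphism of `ℂ[d₁, …, dₙ]` with `dᵢ ↦ dᵢ - aᵢ`. -/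
def shift (a : Fin n → ℤ) : PD n →ₐ[ℂ] PD n :=
  MvPolynomial.aeval fun i => MvPolynomial.X i - MvPolynomial.C (a i : ℂ)

/-- `λ^a = λ₁^{a₁} ⋯ λₙ^{aₙ}`. -/
def monoVal (lam : Fin n → ℂˣ) (a : Fin n → ℤ) : ℂˣ := ∏ i, lam i ^ a i

lemma monoVal_add (lam : Fin n → ℂˣ) (a b : Fin n → ℤ) :
    monoVal lam (a + b) = monoVal lam a * monoVal lam b := by
  simp [monoVal, zpow_add, Finset.prod_mul_distrib]

lemma shift_X (a : Fin n → ℤ) (i : Fin n) :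
    shift a (MvPolynomial.X i) = MvPolynomial.X i - MvPolynomial.C (a i : ℂ) := by
  simp [shift]

lemma shift_add (a b : Fin n → ℤ) (p : PD n) : shift (a + b) p = shift a (shift b p) := by
  have : shift (a + b) = (shift a).comp (shift b) := by
    refine MvPolynomial.algHom_ext fun i => ?_
    rw [AlgHom.comp_apply, shift_X, shift_X, map_sub, shift_X, ← MvPolynomial.algebraMap_eq,
      AlgHom.commutes]
    simp only [Pi.add_apply, Int.cast_add, map_add]
    ring
  rw [this, AlgHom.comp_apply]

/-- The action of `A` on `ℂ[d₁, …, dₙ]` for which `t^a` acts as `λ^a τ^a`. -/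
def laurentAct (lam : Fin n → ℂˣ) : Laurent n →ₗ[ℂ] Module.End ℂ (PD n) :=
  (AddMonoidAlgebra.basis (Fin n → ℤ) ℂ).constr ℂ fun a => (monoVal lam a : ℂ) • (shift a).toLinearMap

lemma laurentAct_mono (lam : Fin n → ℂˣ) (a : Fin n → ℤ) (p : PD n) :
    laurentAct lam (mono a) p = (monoVal lam a : ℂ) • shift a p := by
  rw [laurentAct, mono_eq_basis, Module.Basis.constr_basis]
  rfl

lemma laurentAct_mul (lam : Fin n → ℂˣ) (f g : Laurent n) (p : PD n) :
    laurentAct lam (f * g) p = laurentAct lam f (laurentAct lam g p) := by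
  have : (LinearMap.mul ℂ (Laurent n)).compr₂ (laurentAct lam)
      = ((LinearMap.mul ℂ (Module.End ℂ (PD n))).comp (laurentAct lam)).compl₂
          (laurentAct lam) := by
    refine laurent_hom_ext fun a => laurent_hom_ext fun b => LinearMap.ext fun p => ?_
    simp only [LinearMap.compr₂_apply, LinearMap.mul_apply', LinearMap.compl₂_apply,
      LinearMap.comp_apply, Module.End.mul_apply, mono_mul, laurentAct_mono, map_smul, smul_smul,
      shift_add, monoVal_add, Units.val_mul, mul_comm]
  have h := LinearMap.congr_fun₂ this f g
  simpa using LinearMap.congr_fun h p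

/-- The polynomial `∑ᵢ cᵢ dᵢ`. -/
def degPoly (n : ℕ) : (Fin n → ℂ) →ₗ[ℂ] PD n where
  toFun c := ∑ i, c i • MvPolynomial.X i
  map_add' c c' := by simp [add_smul, Finset.sum_add_distrib]
  map_smul' r c := by simp [Finset.smul_sum, mul_smul]

lemma shift_degPoly (a : Fin n → ℤ) (c : Fin n → ℂ) :
    shift a (degPoly n c) = degPoly n c - MvPolynomial.C (pairing c a) := by
  simp only [degPoly, LinearMap.coe_mk, AddHom.coe_mk, map_sum, map_smul, shift_X, smul_sub,
    Finset.sum_sub_distrib, pairing]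
  congr 1
  refine Finset.sum_congr rfl fun i _ => ?_
  rw [MvPolynomial.smul_eq_C_mul, ← map_mul]

lemma degPoly_laurentAct (lam : Fin n → ℂˣ) (c : Fin n → ℂ) (f : Laurent n) (p : PD n) :
    degPoly n c * laurentAct lam f p - laurentAct lam f (degPoly n c * p)
      = laurentAct lam (degMap c f) p := by
  have : (LinearMap.mulLeft ℂ (degPoly n c)).compRight ℂ ∘ₗ laurentAct lam
      - (LinearMap.lcomp ℂ (PD n) (LinearMap.mulLeft ℂ (degPoly n c))) ∘ₗ laurentAct lam
      = laurentAct lam ∘ₗ degMap c := by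
    refine laurent_hom_ext fun a => LinearMap.ext fun p => ?_
    change degPoly n c * laurentAct lam (mono a) p - laurentAct lam (mono a) (degPoly n c * p)
      = laurentAct lam (degMap c (mono a)) p
    rw [degMap_mono, map_smul, LinearMap.smul_apply]
    simp only [laurentAct_mono, map_mul, shift_degPoly, MvPolynomial.smul_eq_C_mul]
    ring
  exact LinearMap.congr_fun (LinearMap.congr_fun this f) p

end Toroidal

/-- The underlying space `M ⊗ ℂ[d₁, …, dₙ]` of the module `M̃(λ, M)`. -/
def TildeModule {n : ℕ} (_lam : Fin n → ℂˣ) (M : Type*) [AddCommGroup M] [Module ℂ M] : Type _ :=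
  M ⊗[ℂ] PD n

namespace TildeModule

variable {n : ℕ} (lam : Fin n → ℂˣ) (M : Type*) [AddCommGroup M] [Module ℂ M]

instance : AddCommGroup (TildeModule lam M) := inferInstanceAs (AddCommGroup (M ⊗[ℂ] PD n))
instance : Module ℂ (TildeModule lam M) := inferInstanceAs (Module ℂ (M ⊗[ℂ] PD n))

/-- The element `v ⊗ p` of `M̃(λ, M)`. -/
def mk (v : M) (p : PD n) : TildeModule lam M := (v ⊗ₜ[ℂ] p : M ⊗[ℂ] PD n)

variable {𝔤 : Type*} [LieRing 𝔤] [LieAlgebra ℂ 𝔤] [LieRingModule 𝔤 M] [LieModule ℂ 𝔤 M]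

/-- The action of the loop algebra: `f ⊗ x` maps `v ⊗ p` to `⁅x, v⁆ ⊗ f p`, where `A` acts on
`ℂ[d₁, …, dₙ]` by `t^a p = λ^a τ^a(p)`. -/
def loopAct : Loop 𝔤 n →ₗ[ℂ] Module.End ℂ (M ⊗[ℂ] PD n) :=
  TensorProduct.lift <| LinearMap.mk₂ ℂ
    (fun f x => TensorProduct.map (LieModule.toEnd ℂ 𝔤 M x) (laurentAct lam f))
    (fun f f' x => by rw [map_add, TensorProduct.map_add_right])
    (fun r f x => by rw [map_smul, TensorProduct.map_smul_right])
    (fun f x x' => by rw [map_add, TensorProduct.map_add_left])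
    (fun r f x => by rw [map_smul, TensorProduct.map_smul_left])

lemma loopAct_tmul (f : Laurent n) (x : 𝔤) (v : M) (p : PD n) :
    loopAct lam M (f ⊗ₜ[ℂ] x : Loop 𝔤 n) (v ⊗ₜ[ℂ] p) = ⁅x, v⁆ ⊗ₜ[ℂ] laurentAct lam f p := rfl

/-- The action of `𝔤̃ₙ`: the loop algebra acts by `loopAct`, `𝒦_A` by zero, and `dᵢ` by
multiplication by `dᵢ` on the second factor. -/
def act : ToroidalAlgebra n 𝔤 →ₗ[ℂ] Module.End ℂ (M ⊗[ℂ] PD n) where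
  toFun u := loopAct lam M u.loop +
    (LinearMap.mulLeft ℂ (degPoly n u.deg)).lTensor M
  map_add' u v := by
    refine TensorProduct.ext' fun m p => ?_
    simp [add_mul, TensorProduct.tmul_add]
    abel
  map_smul' r u := by
    refine TensorProduct.ext' fun m p => ?_
    simp

lemma act_apply (u : ToroidalAlgebra n 𝔤) (w : M ⊗[ℂ] PD n) :
    act lam M u w = loopAct lam M u.loop w
      + (LinearMap.mulLeft ℂ (degPoly n u.deg)).lTensor M w := rfl

lemma loopAct_lie (u v : Loop 𝔤 n) (w : M ⊗[ℂ] PD n) :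
    loopAct lam M (loopLie 𝔤 n u v) w
      = loopAct lam M u (loopAct lam M v w) - loopAct lam M v (loopAct lam M u w) := by
  induction u using TensorProduct.induction_on with
  | zero => simp
  | add u u' hu hu' => simp only [map_add, LinearMap.add_apply, hu, hu']; abel
  | tmul f x =>
    induction v using TensorProduct.induction_on with
    | zero => simp
    | add v v' hv hv' => simp only [map_add, LinearMap.add_apply, hv, hv']; abel
    | tmul g y =>
      induction w using TensorProduct.induction_on with
      | zero => simp
      | add w w' hw hw' => simp only [map_add, hw, hw']; abel
      | tmul m p =>
        simp only [loopLie_tmul, loopAct_tmul]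
        rw [← laurentAct_mul, ← laurentAct_mul, mul_comm g f, ← TensorProduct.sub_tmul, lie_lie]

lemma loopAct_deg (c : Fin n → ℂ) (u : Loop 𝔤 n) (w : M ⊗[ℂ] PD n) :
    loopAct lam M (degLoop c u) w
      = (LinearMap.mulLeft ℂ (degPoly n c)).lTensor M (loopAct lam M u w)
        - loopAct lam M u ((LinearMap.mulLeft ℂ (degPoly n c)).lTensor M w) := by
  induction u using TensorProduct.induction_on with
  | zero => simp
  | add u u' hu hu' => simp only [map_add, LinearMap.add_apply, hu, hu']; abel
  | tmul f x =>
    induction w using TensorProduct.induction_on with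
    | zero => simp
    | add w w' hw hw' => simp only [map_add, hw, hw']; abel
    | tmul m p =>
      simp only [degLoop_tmul, loopAct_tmul, LinearMap.lTensor_tmul, LinearMap.mulLeft_apply]
      rw [← TensorProduct.tmul_sub, degPoly_laurentAct]

lemma mulLeft_comm (c c' : Fin n → ℂ) (w : M ⊗[ℂ] PD n) :
    (LinearMap.mulLeft ℂ (degPoly n c)).lTensor M ((LinearMap.mulLeft ℂ (degPoly n c')).lTensor M w)
      = (LinearMap.mulLeft ℂ (degPoly n c')).lTensor M
          ((LinearMap.mulLeft ℂ (degPoly n c)).lTensor M w) := by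
  induction w using TensorProduct.induction_on with
  | zero => simp
  | add w w' hw hw' => simp only [map_add, hw, hw']
  | tmul m p => simp [mul_left_comm]

lemma act_leibniz (u v : ToroidalAlgebra n 𝔤) (w : M ⊗[ℂ] PD n) :
    act lam M u (act lam M v w) = act lam M ⁅u, v⁆ w + act lam M v (act lam M u w) := by
  simp only [act_apply, ToroidalAlgebra.loop_lie, ToroidalAlgebra.deg_lie, map_add, map_sub,
    LinearMap.add_apply, LinearMap.sub_apply, loopAct_lie, loopAct_deg, map_zero,
    mulLeft_comm M u.deg v.deg, LinearMap.mulLeft_zero_eq_zero, LinearMap.lTensor_zero,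
    LinearMap.zero_apply]
  abel

instance : LieRingModule (ToroidalAlgebra n 𝔤) (TildeModule lam M) where
  bracket u w := act lam M u w
  add_lie u v w := LinearMap.congr_fun (map_add (act lam M) u v) w
  lie_add u w w' := map_add (act lam M u) w w'
  leibniz_lie u v w := act_leibniz lam M u v w

instance : LieModule ℂ (ToroidalAlgebra n 𝔤) (TildeModule lam M) where
  smul_lie r u w := LinearMap.congr_fun (map_smul (act lam M) r u) w
  lie_smul r u w := map_smul (act lam M u) r w

/-- `x(a) (v ⊗ p) = λ^a (x v) ⊗ τ^a(p)`. -/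
lemma elt_lie_mk (x : 𝔤) (a : Fin n → ℤ) (v : M) (p : PD n) :
    ⁅(ToroidalAlgebra.elt x a : ToroidalAlgebra n 𝔤), mk lam M v p⁆
      = (monoVal lam a : ℂ) • mk lam M ⁅x, v⁆ (shift a p) := by
  change act lam M _ (v ⊗ₜ[ℂ] p) = (monoVal lam a : ℂ) • (⁅x, v⁆ ⊗ₜ[ℂ] shift a p)
  simp [act_apply, ToroidalAlgebra.elt, loopElt, loopAct_tmul, laurentAct_mono]

/-- `t^a Kⱼ` acts by zero. -/
lemma central_lie (a : Fin n → ℤ) (j : Fin n) (w : TildeModule lam M) :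
    ⁅(ToroidalAlgebra.central a j : ToroidalAlgebra n 𝔤), w⁆ = 0 := by
  have h : act lam M (ToroidalAlgebra.central a j : ToroidalAlgebra n 𝔤) = 0 :=
    LinearMap.ext fun w => by simp [act_apply, ToroidalAlgebra.central]
  exact LinearMap.congr_fun h w

/-- `dⱼ (v ⊗ p) = v ⊗ dⱼ p`. -/
lemma der_lie_mk (j : Fin n) (v : M) (p : PD n) :
    ⁅(ToroidalAlgebra.der j : ToroidalAlgebra n 𝔤), mk lam M v p⁆
      = mk lam M v (MvPolynomial.X j * p) := by
  classical
  change act lam M _ (v ⊗ₜ[ℂ] p) = v ⊗ₜ[ℂ] (MvPolynomial.X j * p)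
  simp [act_apply, ToroidalAlgebra.der, degPoly, Pi.single_apply]

end TildeModule

end

/-! Let `N` be free of rank one over `U(𝔥̃ₙ)`, with free generator `e⁻¹(1)`. A weight vector
`x(a)` acts on `N ≅ U(𝔥̃ₙ)` as a translation of polynomials followed by multiplication by its
symbol, the element of `U(𝔥̃ₙ)` by which it acts on the generator. For an `𝔰𝔩₂`-triple `x, y, h`
of Chevalley generators, the symbols `E a`, `F a`, `H a` of `x(a)`, `y(a)`, `h(a)` are polynomials
in `h` with coefficients in the remaining coordinates. The Casimir element gives
`deg (E 0) + deg (F 0) = 2` with constant leading coefficients. Comparing the two leading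
coefficients in `[x(a), x(0)] = 0` shows that `deg (E a)` does not depend on `a`, and that the
second coefficient of `E 0` is invariant under the translations by `a`; the remaining case, the
constant coefficient of a quadratic `E 0`, is settled by an elimination. Hence `E 0` does not
involve the `dᵢ`, and then `E a = λ^a E 0` for a character `λ`.

So the subspace `W = U(𝔥) e⁻¹(1)` is stable under all Chevalley generators, hence under `𝔤`, and
the elements `x` of `𝔤` such that `x(a)` acts on `W` as `λ^a x` form a nonzero ideal, which is `𝔤`
by simplicity. As the Killing form is nonzero, comparing the two sides of the commutation relation
of `x(a)` and `y(b)` on `W` shows that `𝒦_A` kills `W`, and `N = W ⊗ ℂ[d₁, …, dₙ]` is `M̃(λ, W)`. -/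

section

open Polynomial

variable {B : Type*} [CommRing B]

lemma nextCoeff_mul_of_domain [IsDomain B] (p q : B[X]) :
    (p * q).nextCoeff = p.leadingCoeff * q.nextCoeff + p.nextCoeff * q.leadingCoeff := by
  rw [← coeff_one_reverse, reverse_mul_of_domain, mul_coeff_one, coeff_one_reverse,
    coeff_one_reverse, coeff_zero_reverse, coeff_zero_reverse]

lemma nextCoeff_taylor (p : B[X]) (s : B) :
    (taylor s p).nextCoeff = p.nextCoeff + p.natDegree * s * p.leadingCoeff := by
  rcases Nat.eq_zero_or_pos p.natDegree with h | h
  · simp [nextCoeff, h]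
  · rw [nextCoeff_of_natDegree_pos h, nextCoeff_of_natDegree_pos (by rwa [natDegree_taylor]),
      natDegree_taylor, taylor_coeff,
      eval_eq_sum_range' (n := 2) ((natDegree_hasseDeriv_le p _).trans_lt (by omega))]
    obtain ⟨m, hm⟩ : ∃ m, p.natDegree = m + 1 := ⟨p.natDegree - 1, by omega⟩
    simp only [Finset.sum_range_succ, Finset.sum_range_zero, hasseDeriv_coeff, leadingCoeff, hm]
    simp [add_comm 1 m]
    ring

lemma map_nextCoeff_sub_of_mul_taylor_eq [IsDomain B] (f : B →+* B) (s : B) {p q : B[X]}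
    (hp : p ≠ 0) (hq : q ≠ 0) (hf : f q.leadingCoeff = q.leadingCoeff)
    (h : p * taylor s (q.map f) = q * taylor s p) :
    f q.nextCoeff - q.nextCoeff = (p.natDegree - q.natDegree : B) * s * q.leadingCoeff := by
  have hlc : f q.leadingCoeff ≠ 0 := by rw [hf]; exact leadingCoeff_ne_zero.2 hq
  have h' := congrArg nextCoeff h
  rw [nextCoeff_mul_of_domain, nextCoeff_mul_of_domain, nextCoeff_taylor, nextCoeff_taylor,
    leadingCoeff_taylor, leadingCoeff_taylor, nextCoeff_map_of_leadingCoeff_ne_zero f hlc,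
    leadingCoeff_map_of_leadingCoeff_ne_zero f hlc, natDegree_map_of_leadingCoeff_ne_zero f hlc,
    hf] at h'
  refine mul_left_cancel₀ (leadingCoeff_ne_zero.2 hp) ?_
  linear_combination h'

lemma natDegree_eq_of_mul_taylor_eq [IsDomain B] [CharZero B] {s : B} (hs : s ≠ 0) {p q : B[X]}
    (hp : p ≠ 0) (hq : q ≠ 0) (h : p * taylor s q = q * taylor s p) :
    p.natDegree = q.natDegree := by
  have := map_nextCoeff_sub_of_mul_taylor_eq (RingHom.id B) s hp hq rfl (by rwa [map_id])
  rw [RingHom.id_apply, sub_self, zero_eq_mul, mul_eq_zero, sub_eq_zero, Nat.cast_inj] at this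
  simpa [hs, hq] using this

lemma eq_C_mul_of_mul_taylor_eq [IsDomain B] [CharZero B] {s : B} (hs : s ≠ 0) {p q : B[X]}
    (hq : IsUnit q.leadingCoeff) (h : p * taylor s q = q * taylor s p) : ∃ r, p = C r * q := by
  obtain ⟨u, hu⟩ := hq
  have hq0 : q ≠ 0 := leadingCoeff_ne_zero.1 (hu ▸ u.ne_zero)
  let r : B := p.leadingCoeff * (u⁻¹ : Bˣ)
  refine ⟨r, ?_⟩
  by_contra hne
  have hp0 : p ≠ 0 := fun hp => hne (by simp [r, hp])
  have hdeg : p.natDegree = q.natDegree := natDegree_eq_of_mul_taylor_eq hs hp0 hq0 h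
  -- `p - r q` satisfies the same relation, hence has the degree of `p`, although the leading
  -- terms cancel.
  have hdeg' : (p - C r * q).natDegree = q.natDegree :=
    natDegree_eq_of_mul_taylor_eq hs (sub_ne_zero.2 hne) hq0 (by
      simp only [map_sub, taylor_mul, taylor_C]
      linear_combination h)
  have hlt : (p - C r * q).degree < p.degree := by
    refine degree_sub_lt_left ?_ hp0 ?_
    · rw [degree_C_mul (by simp [r, hp0]), degree_eq_natDegree hp0, degree_eq_natDegree hq0, hdeg]
    · rw [leadingCoeff_mul, leadingCoeff_C, mul_assoc, ← hu, Units.inv_mul, mul_one]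
  have := natDegree_lt_natDegree (sub_ne_zero.2 hne) hlt
  omega

lemma eq_C_of_taylor_eq [IsDomain B] [CharZero B] {s : B} (hs : s ≠ 0) {p : B[X]}
    (h : taylor s p = p) : ∃ r, p = C r := by
  obtain ⟨r, hr⟩ := eq_C_mul_of_mul_taylor_eq hs (p := p) (q := 1) (by simp) (by simp [h])
  exact ⟨r, by rw [hr, mul_one]⟩

lemma eq_zero_or_sq_eq_of_quadratic_mul_taylor_eq [IsDomain B] [CharZero B] {s : B} (hs : s ≠ 0)
    {c₀ c₁ c₂ e₀ e₁ e₂ δ : B} (he₂ : e₂ ≠ 0)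
    (h : (C e₂ * X ^ 2 + C e₁ * X + C e₀) * taylor s (C c₂ * X ^ 2 + C c₁ * X + C (c₀ + δ))
      = (C c₂ * X ^ 2 + C c₁ * X + C c₀) * taylor s (C e₂ * X ^ 2 + C e₁ * X + C e₀)) :
    δ = 0 ∨ (δ + s ^ 2 * c₂) ^ 2 = s ^ 2 * (c₁ ^ 2 - 4 * c₂ * c₀) := by
  have hx : ∀ x : B, (e₂ * x ^ 2 + e₁ * x + e₀) * (c₂ * (x + s) ^ 2 + c₁ * (x + s) + (c₀ + δ))
      = (c₂ * x ^ 2 + c₁ * x + c₀) * (e₂ * (x + s) ^ 2 + e₁ * (x + s) + e₀) := fun x => by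
    simpa [taylor_eval] using congrArg (eval x) h
  have h₀ : s ^ 2 * (e₀ * c₂ - c₀ * e₂) + s * (e₀ * c₁ - c₀ * e₁) + δ * e₀ = 0 := by
    linear_combination hx 0
  have h₁ : s ^ 2 * (e₁ * c₂ - e₂ * c₁) + 2 * s * (e₀ * c₂ - e₂ * c₀) + δ * e₁ = 0 := by
    refine mul_left_cancel₀ (mul_ne_zero two_ne_zero hs) ?_
    linear_combination hx s - hx (-s)
  have h₂ : s * (e₁ * c₂ - e₂ * c₁) + δ * e₂ = 0 := by
    refine mul_left_cancel₀ (mul_ne_zero two_ne_zero (pow_ne_zero 2 hs)) ?_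
    linear_combination hx s + hx (-s) - 2 * hx 0
  have hδ : δ * ((δ + s ^ 2 * c₂) ^ 2 - s ^ 2 * (c₁ ^ 2 - 4 * c₂ * c₀)) = 0 := by
    refine mul_left_cancel₀ he₂ ?_
    linear_combination 2 * s ^ 2 * c₂ * (c₂ * h₀ + c₀ * h₂)
      - (s ^ 2 * c₂ + s * c₁ + δ) * (s * c₂ * h₁ - (s ^ 2 * c₂ + δ) * h₂)
  exact (mul_eq_zero.1 hδ).imp_right sub_eq_zero.1

end

lemma addMonoidHom_eq_zero_of_bddBelow {G : Type*} [AddGroup G] (f : G →+ ℤ)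
    (hf : BddBelow (Set.range f)) : f = 0 := by
  obtain ⟨C, hC⟩ := hf
  ext a
  by_contra ha
  have h : C ≤ -(|C| + 1) * f a * f a := by
    simpa [mul_assoc] using hC (Set.mem_range_self ((-(|C| + 1) * f a) • a))
  have : 0 < f a * f a := mul_self_pos.2 ha
  nlinarith [neg_abs_le C, abs_nonneg C]

/-- The properties of an action by translations on a polynomial ring that are used in the study
of loop `𝔰𝔩₂`-systems: units are constant, and a polynomial is invariant under the translation by
a vector once it is invariant under the translation by twice that vector. -/
structure IsTranslationAction {G B : Type*} [AddCommGroup G] [CommRing B]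
    (τ : G → B →+* B) : Prop where
  map_zero : τ 0 = RingHom.id B
  map_add (a b : G) (x : B) : τ (a + b) x = τ a (τ b x)
  map_of_isUnit (a : G) {x : B} (hx : IsUnit x) : τ a x = x
  map_of_map_add_self (a : G) {x : B} (hx : τ (a + a) x = x) : τ a x = x

namespace IsTranslationAction

variable {G B : Type*} [AddCommGroup G] [CommRing B] [IsDomain B] [CharZero B]
  {τ : G → B →+* B} (hτ : IsTranslationAction τ)
include hτ

lemma map_eq_of_quadratic {g k m : B} (hk : k ≠ 0) (hτk : ∀ a, τ a k = k) (hτm : ∀ a, τ a m = m)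
    (h : ∀ a, τ a g - g = 0 ∨ (τ a g - g + k) ^ 2 = m - 4 * k * g) (a : G) : τ a g = g := by
  by_contra hne
  have hne' : τ (a + a) g ≠ g := fun h' => hne (hτ.map_of_map_add_self a h')
  have h₁ := (h a).resolve_left (sub_ne_zero.2 hne)
  have h₂ := (h (a + a)).resolve_left (sub_ne_zero.2 hne')
  obtain ⟨x, hx⟩ : ∃ x, τ a g = g + x := ⟨_, (add_sub_cancel _ _).symm⟩
  have hx₀ : x ≠ 0 := by rintro rfl; exact hne (by rw [hx, add_zero])
  have h₃ : (τ a x + k) ^ 2 = (x - k) ^ 2 := by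
    have := congrArg (τ a) h₁
    simp only [map_pow, RingHom.map_add, map_sub, map_mul, map_ofNat, hτk, hτm, hx] at this h₁
    linear_combination this - h₁
  have h₄ : τ a x * (τ a x + 2 * x + 2 * k) = 0 := by
    rw [hτ.map_add, hx, RingHom.map_add, hx] at h₂
    rw [hx] at h₁
    linear_combination h₂ - h₁
  rcases mul_eq_zero.1 h₄ with hy | hy
  · have hxk : x = 2 * k := by
      rw [hy] at h₃
      exact mul_left_cancel₀ hx₀ (by linear_combination -h₃)
    rw [hxk, map_mul, map_ofNat, hτk] at hy
    exact mul_ne_zero two_ne_zero hk hy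
  · have hxk : x = -2 * k := by
      refine mul_left_cancel₀ (mul_ne_zero (OfNat.ofNat_ne_zero 3) hx₀) ?_
      linear_combination h₃ - (τ a x - 2 * x) * hy
    rw [hxk, map_mul, map_neg, map_ofNat, hτk] at hy
    exact mul_ne_zero (OfNat.ofNat_ne_zero 4) hk (by linear_combination -hy)

end IsTranslationAction

open Polynomial in
/-- The relations satisfied by the values `E a` at a free generator of commuting operators of
weight `-s` and degree `a`; here `U(𝔥̃ₙ) = B[X]`, the translation `τ a` acts on the coefficients
and the weight on the variable. -/
structure IsCommutingFamily {G B : Type*} [AddCommGroup G] [CommRing B] (τ : G → B →+* B) (s : ℤ)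
    (E : G → B[X]) : Prop where
  ne_zero (a : G) : E a ≠ 0
  isUnit_leadingCoeff : IsUnit (E 0).leadingCoeff
  mul_taylor (a : G) : E a * taylor (s : B) ((E 0).map (τ a)) = E 0 * taylor (s : B) (E a)

namespace IsCommutingFamily

open Polynomial

variable {G B : Type*} [AddCommGroup G] [CommRing B] [IsDomain B] [CharZero B]
  {τ : G → B →+* B} (hτ : IsTranslationAction τ) {s : ℤ} (hs : s ≠ 0) {E : G → B[X]}
  (hE : IsCommutingFamily τ s E)
include hτ hE

omit [CharZero B] in
lemma map_nextCoeff (a : G) : τ a (E 0).nextCoeff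
    = (E 0).nextCoeff + ((E a).natDegree - (E 0).natDegree : ℤ) * s * (E 0).leadingCoeff := by
  have := map_nextCoeff_sub_of_mul_taylor_eq (τ a) s (hE.ne_zero a) (hE.ne_zero 0)
    (hτ.map_of_isUnit a hE.isUnit_leadingCoeff) (hE.mul_taylor a)
  push_cast
  linear_combination this

include hs

-- By `map_nextCoeff` the difference of the degrees is additive in `a`, and it is bounded below.
lemma natDegree_eq (a : G) : (E a).natDegree = (E 0).natDegree := by
  let f : G →+ ℤ := AddMonoidHom.mk' (fun a => (E a).natDegree - (E 0).natDegree) fun a b => by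
    have hs' : (s * (E 0).leadingCoeff : B) ≠ 0 :=
      mul_ne_zero (Int.cast_ne_zero.2 hs) hE.isUnit_leadingCoeff.ne_zero
    refine Int.cast_injective (α := B) (mul_right_cancel₀ hs' ?_)
    have h := hτ.map_add a b (E 0).nextCoeff
    rw [hE.map_nextCoeff hτ b, map_add, hE.map_nextCoeff hτ a, hE.map_nextCoeff hτ, map_mul,
      map_mul, map_intCast, map_intCast, hτ.map_of_isUnit a hE.isUnit_leadingCoeff] at h
    rw [Int.cast_add]
    linear_combination h
  have hf : f = 0 := addMonoidHom_eq_zero_of_bddBelow f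
    ⟨-(E 0).natDegree, by rintro _ ⟨b, rfl⟩; simp [f]⟩
  have : ((E a).natDegree : ℤ) - (E 0).natDegree = 0 := DFunLike.congr_fun hf a
  omega

lemma map_nextCoeff_eq (a : G) : τ a (E 0).nextCoeff = (E 0).nextCoeff := by
  rw [hE.map_nextCoeff hτ, hE.natDegree_eq hτ hs a]
  simp

lemma map_coeff_zero_of_natDegree_eq_two (hdeg : (E 0).natDegree = 2) (a : G) :
    τ a ((E 0).coeff 0) = (E 0).coeff 0 := by
  have hquad : ∀ p : B[X], p.natDegree = 2 →
      p = C (p.coeff 2) * X ^ 2 + C (p.coeff 1) * X + C (p.coeff 0) := fun p hp =>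
    eq_quadratic_of_degree_le_two (natDegree_le_iff_degree_le.1 hp.le)
  have hu : IsUnit ((E 0).coeff 2) := by
    have := hE.isUnit_leadingCoeff
    rwa [leadingCoeff, hdeg] at this
  have h₁ : ∀ a, τ a ((E 0).coeff 1) = (E 0).coeff 1 := fun a => by
    have := hE.map_nextCoeff_eq hτ hs a
    rwa [nextCoeff_of_natDegree_pos (by omega), hdeg] at this
  have hs' : (s : B) ≠ 0 := Int.cast_ne_zero.2 hs
  refine hτ.map_eq_of_quadratic (k := s ^ 2 * (E 0).coeff 2) (m := s ^ 2 * (E 0).coeff 1 ^ 2)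
    (mul_ne_zero (pow_ne_zero 2 hs') hu.ne_zero) (fun a => ?_) (fun a => ?_) (fun a => ?_) a
  · rw [map_mul, map_pow, map_intCast, hτ.map_of_isUnit a hu]
  · rw [map_mul, map_pow, map_pow, map_intCast, h₁]
  · have hdega := (hE.natDegree_eq hτ hs a).trans hdeg
    have he₂ : (E a).coeff 2 ≠ 0 := hdega ▸ leadingCoeff_ne_zero.2 (hE.ne_zero a)
    have hmap : (E 0).map (τ a) = C ((E 0).coeff 2) * X ^ 2 + C ((E 0).coeff 1) * X
        + C ((E 0).coeff 0 + (τ a ((E 0).coeff 0) - (E 0).coeff 0)) := by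
      conv_lhs => rw [hquad _ hdeg]
      simp [hτ.map_of_isUnit a hu, h₁]
    have hmul := hE.mul_taylor a
    rw [hmap, hquad _ hdega] at hmul
    conv_rhs at hmul => rw [hquad _ hdeg]
    refine (eq_zero_or_sq_eq_of_quadratic_mul_taylor_eq hs' he₂ hmul).imp_right fun h => ?_
    linear_combination h

theorem map_eq_of_natDegree_le_two (hdeg : (E 0).natDegree ≤ 2) (a : G) :
    (E 0).map (τ a) = E 0 := by
  ext i
  rw [coeff_map]
  rcases lt_trichotomy i (E 0).natDegree with hi | rfl | hi
  · obtain rfl | rfl : i = (E 0).natDegree - 1 ∨ i = 0 := by omega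
    · have := hE.map_nextCoeff_eq hτ hs a
      rwa [nextCoeff_of_natDegree_pos (by omega)] at this
    · obtain h | h : (E 0).natDegree = 1 ∨ (E 0).natDegree = 2 := by omega
      · have := hE.map_nextCoeff_eq hτ hs a
        rwa [nextCoeff_of_natDegree_pos (by omega), h] at this
      · exact hE.map_coeff_zero_of_natDegree_eq_two hτ hs h a
  · exact hτ.map_of_isUnit a hE.isUnit_leadingCoeff
  · rw [coeff_eq_zero_of_natDegree_lt hi, _root_.map_zero]

end IsCommutingFamily

open Polynomial in
/-- The relations satisfied by the values at a free generator of the operators `e(a)`, `f(a)` and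
`h(a)` of `𝔰𝔩₂ ⊗ A`, where `U(𝔥̃ₙ) = B[X]` with `X = h(0)`. -/
structure LoopSl2System {G B : Type*} [AddCommGroup G] [CommRing B] (τ : G → B →+* B)
    (E F H : G → B[X]) : Prop where
  h_zero : H 0 = X
  lie_h_e (a b : G) :
    H a * (E b).map (τ a) - E b * taylor (-2) ((H a).map (τ b)) = 2 * E (a + b)
  lie_h_f (a b : G) :
    H a * (F b).map (τ a) - F b * taylor 2 ((H a).map (τ b)) = -2 * F (a + b)
  lie_e_f (a : G) : E a * taylor (-2) ((F 0).map (τ a)) - F 0 * taylor 2 (E a) = H a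
  lie_e_e (a : G) : E a * taylor (-2) ((E 0).map (τ a)) = E 0 * taylor (-2) (E a)
  lie_f_f (a : G) : F a * taylor 2 ((F 0).map (τ a)) = F 0 * taylor 2 (F a)

namespace LoopSl2System

open Polynomial

variable {G B : Type*} [AddCommGroup G] [CommRing B] [IsDomain B] [CharZero B]
  {τ : G → B →+* B} (hτ : IsTranslationAction τ) {E F H : G → B[X]} (S : LoopSl2System τ E F H)
include hτ S

-- `4 g` is the value of the Casimir element `2 (e f + f e) + h ^ 2` at the generator, up to a
-- constant.
lemma exists_casimir : ∃ g, 4 * (taylor 2 (E 0) * F 0) = C g - X ^ 2 - 2 * X := by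
  let Q := 4 * (taylor 2 (E 0) * F 0) + X ^ 2 + 2 * X
  suffices h : taylor (-2) Q = Q by
    obtain ⟨g, hg⟩ := eq_C_of_taylor_eq (neg_ne_zero.2 two_ne_zero) h
    exact ⟨g, by rw [← hg]; ring⟩
  have h := S.lie_e_f 0
  rw [hτ.map_zero, map_id, S.h_zero] at h
  have hE : taylor (-2) (taylor 2 (E 0)) = E 0 := by
    rw [taylor_taylor, neg_add_cancel, taylor_zero]
  have hC₂ : C (2 : B) = 2 := map_ofNat C 2
  have h₂ : taylor (-2 : B) 2 = 2 := by rw [← hC₂, taylor_C]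
  have h₄ : taylor (-2 : B) 4 = 4 := by rw [← map_ofNat C 4, taylor_C]
  simp only [Q, map_add, taylor_mul, hE, taylor_X, taylor_X_pow, h₂, h₄, map_neg, hC₂]
  linear_combination 4 * h

lemma natDegree_add_and_isUnit : (E 0).natDegree + (F 0).natDegree = 2 ∧
    IsUnit (E 0).leadingCoeff ∧ IsUnit (F 0).leadingCoeff := by
  obtain ⟨g, hg⟩ := S.exists_casimir hτ
  have hdeg : (X ^ 2 + 2 * X - C g).natDegree = 2 := by
    rw [← map_ofNat C 2]; compute_degree!
  have hmonic : (X ^ 2 + 2 * X - C g).Monic := by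
    rw [← map_ofNat C 2]; monicity!
  have hprod : C (-4) * (taylor 2 (E 0) * F 0) = X ^ 2 + 2 * X - C g := by
    rw [map_neg, map_ofNat]; linear_combination -hg
  have hlc : -4 * ((E 0).leadingCoeff * (F 0).leadingCoeff) = 1 := by
    rw [← leadingCoeff_taylor (r := 2) (f := E 0), ← leadingCoeff_mul,
      ← leadingCoeff_C (-4), ← leadingCoeff_mul, hprod, hmonic.leadingCoeff]
  refine ⟨?_, .of_mul_eq_one (-4 * (F 0).leadingCoeff) (by linear_combination hlc),
    .of_mul_eq_one (-4 * (E 0).leadingCoeff) (by linear_combination hlc)⟩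
  have hne : ∀ p q : B, -4 * (p * q) = 1 → p ≠ 0 ∧ q ≠ 0 := by
    intro p q h
    constructor <;> rintro rfl <;> simp at h
  obtain ⟨hE, hF⟩ := hne _ _ hlc
  rw [leadingCoeff_ne_zero] at hE hF
  rw [← hdeg, ← hprod, natDegree_C_mul (neg_ne_zero.2 (OfNat.ofNat_ne_zero 4)),
    natDegree_mul ((taylor_eq_zero _ _).not.2 hE) hF, natDegree_taylor]

lemma isCommutingFamily_e : IsCommutingFamily τ (-2) E where
  ne_zero a ha := by
    have h := S.lie_h_e (-a) a
    rw [ha, Polynomial.map_zero, mul_zero, zero_mul, sub_self, neg_add_cancel, eq_comm] at h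
    have hE : E 0 = 0 := (mul_eq_zero.1 h).resolve_left two_ne_zero
    simpa [hE] using (S.natDegree_add_and_isUnit hτ).2.1
  isUnit_leadingCoeff := (S.natDegree_add_and_isUnit hτ).2.1
  mul_taylor a := by simpa using S.lie_e_e a

lemma isCommutingFamily_f : IsCommutingFamily τ 2 F where
  ne_zero a ha := by
    have h := S.lie_h_f (-a) a
    rw [ha, Polynomial.map_zero, mul_zero, zero_mul, sub_self, neg_add_cancel, eq_comm] at h
    have hF : F 0 = 0 := (mul_eq_zero.1 h).resolve_left (neg_ne_zero.2 two_ne_zero)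
    simpa [hF] using (S.natDegree_add_and_isUnit hτ).2.2
  isUnit_leadingCoeff := (S.natDegree_add_and_isUnit hτ).2.2
  mul_taylor a := by simpa using S.lie_f_f a

theorem map_e_zero (a : G) : (E 0).map (τ a) = E 0 :=
  (S.isCommutingFamily_e hτ).map_eq_of_natDegree_le_two hτ (by norm_num)
    (by have := (S.natDegree_add_and_isUnit hτ).1; omega) a

theorem map_f_zero (a : G) : (F 0).map (τ a) = F 0 :=
  (S.isCommutingFamily_f hτ).map_eq_of_natDegree_le_two hτ (by norm_num)
    (by have := (S.natDegree_add_and_isUnit hτ).1; omega) a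

lemma exists_e_eq_C_mul (a : G) : ∃ r, E a = C r * E 0 := by
  refine eq_C_mul_of_mul_taylor_eq (neg_ne_zero.2 two_ne_zero)
    (S.natDegree_add_and_isUnit hτ).2.1 ?_
  rw [← S.lie_e_e a, S.map_e_zero hτ]

lemma h_eq_C_mul_X {a : G} {r : B} (hr : E a = C r * E 0) : H a = C r * X := by
  have h := S.lie_e_f 0
  rw [hτ.map_zero, map_id, S.h_zero] at h
  rw [← S.lie_e_f, S.map_f_zero hτ, hr, taylor_mul, taylor_C]
  linear_combination C r * h

theorem exists_character : ∃ r : G → Bˣ, (∀ a b, r (a + b) = r a * r b) ∧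
    ∀ a, E a = C (r a : B) * E 0 := by
  choose r hr using S.exists_e_eq_C_mul hτ
  have hr₀ : r 0 = 1 := by
    have h : C (r 0) * E 0 = 1 * E 0 := by rw [one_mul, ← hr]
    exact C_injective (mul_right_cancel₀ ((S.isCommutingFamily_e hτ).ne_zero 0) h)
  have hmul : ∀ a b, r a * τ a (r b) = r (a + b) := fun a b => by
    have h := S.lie_h_e a b
    rw [S.h_eq_C_mul_X hτ (hr a), hr b, hr (a + b), Polynomial.map_mul, map_C, S.map_e_zero hτ,
      Polynomial.map_mul, map_C, map_X, taylor_mul, taylor_C, taylor_X] at h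
    have h' : C (r a) * X * C (τ a (r b)) - C (r b) * (C (τ b (r a)) * (X + C (-2)))
        = 2 * C (r (a + b)) :=
      mul_right_cancel₀ ((S.isCommutingFamily_e hτ).ne_zero 0) (by linear_combination h)
    have h₂ := congrArg (eval 2) h'
    simp only [eval_sub, eval_mul, eval_add, eval_C, eval_X, eval_ofNat, add_neg_cancel, mul_zero,
      sub_zero] at h₂
    exact mul_left_cancel₀ two_ne_zero (by linear_combination h₂)
  have hunit : ∀ a, IsUnit (r a) := fun a =>
    .of_mul_eq_one (τ a (r (-a))) (by rw [hmul, add_neg_cancel, hr₀])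
  refine ⟨fun a => (hunit a).unit, fun a b => Units.ext ?_, hr⟩
  rw [Units.val_mul, IsUnit.unit_spec, IsUnit.unit_spec, IsUnit.unit_spec, ← hmul,
    hτ.map_of_isUnit a (hunit b)]

end LoopSl2System

noncomputable section

namespace EnvelopingAlgebra

open UniversalEnvelopingAlgebra

attribute [local instance] LieRing.ofAssociativeRing

variable {R : Type*} [CommRing R] {L : Type*} [LieRing L] [LieAlgebra R L]

lemma adjoin_range_ι :
    Algebra.adjoin R (Set.range (ι R : L → UniversalEnvelopingAlgebra R L)) = ⊤ := by
  let S := Algebra.adjoin R (Set.range (ι R : L → UniversalEnvelopingAlgebra R L))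
  let f : L →ₗ⁅R⁆ S :=
    { toFun := fun x => ⟨ι R x, Algebra.subset_adjoin ⟨x, rfl⟩⟩
      map_add' := fun x y => Subtype.ext (map_add _ x y)
      map_smul' := fun r x => Subtype.ext (map_smul _ r x)
      map_lie' := fun {x y} => Subtype.ext ((ι R).map_lie x y) }
  have hf : S.val.comp (lift R f) = AlgHom.id R _ :=
    hom_ext R (LieHom.ext fun x => congrArg Subtype.val (lift_ι_apply R f x))
  exact eq_top_iff.2 fun u _ => (congrArg (· ∈ S) (AlgHom.congr_fun hf u)).mp (lift R f u).2

lemma induction_on {motive : UniversalEnvelopingAlgebra R L → Prop}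
    (algebraMap : ∀ r, motive (algebraMap R _ r)) (ι : ∀ x, motive (ι R x))
    (add : ∀ u v, motive u → motive v → motive (u + v))
    (mul : ∀ u v, motive u → motive v → motive (u * v)) (u : UniversalEnvelopingAlgebra R L) :
    motive u :=
  Algebra.adjoin_induction (p := fun u _ => motive u) (by rintro _ ⟨x, rfl⟩; exact ι x) algebraMap
    (fun u v _ _ => add u v) (fun u v _ _ => mul u v)
    (adjoin_range_ι (R := R) (L := L) ▸ Algebra.mem_top : u ∈ Algebra.adjoin R _)

lemma algHom_ext {A : Type*} [Ring A] [Algebra R A] {f g : UniversalEnvelopingAlgebra R L →ₐ[R] A}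
    (h : ∀ x, f (ι R x) = g (ι R x)) : f = g :=
  hom_ext R (LieHom.ext h)

lemma algHom_ext_basis {κ A : Type*} [Ring A] [Algebra R A] (v : Module.Basis κ R L)
    {f g : UniversalEnvelopingAlgebra R L →ₐ[R] A} (h : ∀ k, f (ι R (v k)) = g (ι R (v k))) :
    f = g := by
  have : f.toLinearMap ∘ₗ (ι R : L →ₗ⁅R⁆ _).toLinearMap
      = g.toLinearMap ∘ₗ (ι R : L →ₗ⁅R⁆ _).toLinearMap := v.ext h
  exact algHom_ext (LinearMap.congr_fun this)

section Abelian

variable [IsLieAbelian L]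

instance instCommRing : CommRing (UniversalEnvelopingAlgebra R L) where
  mul_comm := by
    have hι : ∀ x ∈ Set.range (ι R), ∀ y ∈ Set.range (ι R),
        x * y = y * (x : UniversalEnvelopingAlgebra R L) := by
      rintro _ ⟨x, rfl⟩ _ ⟨y, rfl⟩
      have h := (ι R).map_lie x y
      rw [trivial_lie_zero, map_zero, LieRing.of_associative_ring_bracket] at h
      exact sub_eq_zero.1 h.symm
    have := Algebra.isMulCommutative_adjoin R hι
    rw [adjoin_range_ι] at this
    exact fun u v => setLike_mul_comm (Algebra.mem_top (R := R)) Algebra.mem_top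

/-- The extension of a linear map with values in a commutative algebra to the enveloping algebra of
an abelian Lie algebra. -/
def liftLinear {A : Type*} [CommRing A] [Algebra R A] (f : L →ₗ[R] A) :
    UniversalEnvelopingAlgebra R L →ₐ[R] A :=
  lift R { f with
    map_lie' := fun {x y} => by
      change f ⁅x, y⁆ = ⁅f x, f y⁆
      rw [trivial_lie_zero, map_zero, LieRing.of_associative_ring_bracket, mul_comm, sub_self] }

lemma liftLinear_ι {A : Type*} [CommRing A] [Algebra R A] (f : L →ₗ[R] A) (x : L) :
    liftLinear f (ι R x) = f x :=
  lift_ι_apply _ _ _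

/-- The automorphism `x ↦ x - χ x` of the enveloping algebra of an abelian Lie algebra: moving a
vector of weight `χ` to the left past `u` turns `u` into `weightShift χ u`. -/
def weightShift (χ : Module.Dual R L) :
    UniversalEnvelopingAlgebra R L →ₐ[R] UniversalEnvelopingAlgebra R L :=
  liftLinear ((ι R : L →ₗ⁅R⁆ _).toLinearMap - (Algebra.linearMap R _).comp χ)

lemma weightShift_ι (χ : Module.Dual R L) (x : L) :
    weightShift χ (ι R x) = ι R x - algebraMap R _ (χ x) :=
  liftLinear_ι _ _

lemma weightShift_zero : weightShift (0 : Module.Dual R L) = AlgHom.id R _ :=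
  algHom_ext fun x => by
    rw [weightShift_ι, LinearMap.zero_apply, map_zero, sub_zero, AlgHom.id_apply]

/-- The enveloping algebra of an abelian Lie algebra with a basis is a polynomial algebra. -/
def equivMvPolynomial {κ : Type*} (v : Module.Basis κ R L) :
    UniversalEnvelopingAlgebra R L ≃ₐ[R] MvPolynomial κ R :=
  AlgEquiv.ofAlgHom (liftLinear (v.constr R MvPolynomial.X))
    (MvPolynomial.aeval fun k => ι R (v k))
    (MvPolynomial.algHom_ext fun k => by
      rw [AlgHom.comp_apply, MvPolynomial.aeval_X, liftLinear_ι, Module.Basis.constr_basis,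
        AlgHom.id_apply])
    (algHom_ext_basis v fun k => by
      rw [AlgHom.comp_apply, liftLinear_ι, Module.Basis.constr_basis, MvPolynomial.aeval_X,
        AlgHom.id_apply])

lemma equivMvPolynomial_ι {κ : Type*} (v : Module.Basis κ R L) (k : κ) :
    equivMvPolynomial v (ι R (v k)) = MvPolynomial.X k := by
  change liftLinear (v.constr R MvPolynomial.X) (ι R (v k)) = _
  rw [liftLinear_ι, Module.Basis.constr_basis]

end Abelian

section Action

variable {H : LieSubalgebra R L} {N : Type*} [AddCommGroup N] [Module R N]
  [LieRingModule L N] [LieModule R L N]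

variable (H N) in
/-- The action of `U(H)` on an `L`-module, for a Lie subalgebra `H` of `L`. -/
def act : UniversalEnvelopingAlgebra R H →ₐ[R] Module.End R N :=
  lift R ((LieModule.toEnd R L N).comp H.incl)

lemma act_ι (x : H) (v : N) : act H N (ι R x) v = ⁅(x : L), v⁆ := by
  rw [act, lift_ι_apply]
  rfl

lemma lie_act [IsLieAbelian H] {x : L} {χ : Module.Dual R H}
    (hx : ∀ y : H, ⁅(y : L), x⁆ = χ y • x) (u : UniversalEnvelopingAlgebra R H) (v : N) :
    ⁅x, act H N u v⁆ = act H N (weightShift χ u) ⁅x, v⁆ := by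
  induction u using induction_on generalizing v with
  | algebraMap r => simp [Module.algebraMap_end_apply]
  | ι y =>
    rw [weightShift_ι, map_sub, LinearMap.sub_apply, act_ι, act_ι, AlgHom.commutes,
      Module.algebraMap_end_apply, leibniz_lie, ← lie_skew, hx, neg_lie, smul_lie]
    abel
  | add u u' hu hu' => simp only [map_add, LinearMap.add_apply, lie_add, hu, hu']
  | mul u u' hu hu' => simp only [map_mul, Module.End.mul_apply, hu, hu']

lemma apply_act_eq_mul (e : N →ₗ[R] UniversalEnvelopingAlgebra R H)
    (he : ∀ (x : H) (v : N), e ⁅(x : L), v⁆ = ι R x * e v)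
    (u : UniversalEnvelopingAlgebra R H) (v : N) : e (act H N u v) = u * e v := by
  induction u using induction_on generalizing v with
  | algebraMap r => rw [AlgHom.commutes, Module.algebraMap_end_apply, map_smul, Algebra.smul_def]
  | ι x => rw [act_ι, he]
  | add u u' hu hu' => simp only [map_add, LinearMap.add_apply, add_mul, hu, hu']
  | mul u u' hu hu' => simp only [map_mul, Module.End.mul_apply, mul_assoc, hu, hu']

end Action

end EnvelopingAlgebra

section Translation

open MvPolynomial

variable {κ R : Type*} [CommRing R]

/-- The translation `p(x) ↦ p(x - c)` of polynomials. -/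
def translateAlgHom (c : κ → R) : MvPolynomial κ R →ₐ[R] MvPolynomial κ R :=
  aeval fun j => X j - C (c j)

lemma translateAlgHom_X (c : κ → R) (j : κ) : translateAlgHom c (X j) = X j - C (c j) :=
  aeval_X _ _

lemma eval_translateAlgHom (c x : κ → R) (p : MvPolynomial κ R) :
    eval x (translateAlgHom c p) = eval (x - c) p := by
  have : (aeval x).comp (translateAlgHom c) = aeval (x - c) := by ext j; simp [translateAlgHom_X]
  exact AlgHom.congr_fun this p

lemma translateAlgHom_zero : translateAlgHom (0 : κ → R) = AlgHom.id R _ := by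
  ext1 j; simp [translateAlgHom_X]

lemma translateAlgHom_add (c d : κ → R) (p : MvPolynomial κ R) :
    translateAlgHom (c + d) p = translateAlgHom c (translateAlgHom d p) := by
  have : translateAlgHom (c + d) = (translateAlgHom c).comp (translateAlgHom d) := by
    ext1 j
    rw [AlgHom.comp_apply, translateAlgHom_X, translateAlgHom_X, map_sub, translateAlgHom_X,
      ← algebraMap_eq, AlgHom.commutes, Pi.add_apply, map_add]
    ring
  exact AlgHom.congr_fun this p

variable [IsDomain R] [CharZero R]

-- The restriction `q` of `p` to the line `x - t c` satisfies `q(t + 2) = q(t)`.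
lemma translateAlgHom_eq_of_translate_add_self {c : κ → R} {p : MvPolynomial κ R}
    (h : translateAlgHom (c + c) p = p) : translateAlgHom c p = p := by
  refine MvPolynomial.funext fun x => ?_
  let line : κ → Polynomial R := fun j => Polynomial.C (x j) - Polynomial.C (c j) * Polynomial.X
  have eval_line (t : R) : (aeval line p).eval t = eval (x - t • c) p := by
    have : (Polynomial.aeval t).comp (aeval line) = aeval (x - t • c) := by
      ext j
      simp only [line, AlgHom.comp_apply, aeval_X, map_sub, map_mul, Polynomial.aeval_C,
        Polynomial.aeval_X, Algebra.algebraMap_self, RingHom.id_apply, mul_comm, Pi.sub_apply,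
        Pi.smul_apply, smul_eq_mul]
    exact AlgHom.congr_fun this p
  have periodic : Polynomial.taylor 2 (aeval line p) = aeval line p := by
    refine Polynomial.funext fun t => ?_
    have h' := eval_translateAlgHom (c + c) (x - t • c) p
    rw [h] at h'
    rw [Polynomial.taylor_eval, eval_line, eval_line, h', sub_sub, add_smul, two_smul]
  obtain ⟨r, hr⟩ := eq_C_of_taylor_eq two_ne_zero periodic
  have h0 := eval_line 0
  have h1 := eval_line 1
  rw [hr, Polynomial.eval_C] at h0 h1
  rw [eval_translateAlgHom, ← one_smul R c, ← h1, h0, zero_smul, sub_zero]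

lemma isTranslationAction_translateAlgHom {G : Type*} [AddCommGroup G] (δ : G →+ κ → R) :
    IsTranslationAction fun a =>
      (translateAlgHom (δ a) : MvPolynomial κ R →+* MvPolynomial κ R) where
  map_zero := by rw [map_zero, translateAlgHom_zero]; rfl
  map_add a b x := by rw [_root_.map_add]; exact translateAlgHom_add _ _ x
  map_of_isUnit a x hx := by
    obtain ⟨r, -, rfl⟩ := isUnit_iff_eq_C_of_isReduced.1 hx
    exact AlgHom.commutes (translateAlgHom (δ a)) r
  map_of_map_add_self a x hx := by
    rw [_root_.map_add] at hx; exact translateAlgHom_eq_of_translate_add_self hx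

lemma eq_C_of_forall_translateAlgHom_intCast_eq {p : MvPolynomial κ R}
    (hp : ∀ a : κ → ℤ, translateAlgHom (fun j => (a j : R)) p = p) : p = C (eval 0 p) := by
  refine funext_set (fun _ => Set.range ((↑) : ℤ → R))
    (fun _ => Set.infinite_range_of_injective Int.cast_injective) fun x hx => ?_
  choose a ha using fun j => hx j (Set.mem_univ j)
  have h := congrArg (eval 0) (hp (-a))
  rw [eval_translateAlgHom] at h
  rw [eval_C, ← h]
  congr 2
  funext j
  simp [← ha j]

end Translation

namespace ToroidalAlgebra

open Toroidal

variable {n : ℕ} {𝔤 : Type*} [LieRing 𝔤] [LieAlgebra ℂ 𝔤]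

/-- The inclusion of the loop algebra `A ⊗ 𝔤`, as a linear map. -/
def ofLoop : Loop 𝔤 n →ₗ[ℂ] ToroidalAlgebra n 𝔤 where
  toFun f := ⟨f, 0, 0⟩
  map_add' f g := by ext1 <;> simp
  map_smul' r f := by ext1 <;> simp

/-- The inclusion of `𝒦_A`, as a linear map. -/
def ofCent : KA n →ₗ[ℂ] ToroidalAlgebra n 𝔤 where
  toFun k := ⟨0, k, 0⟩
  map_add' k k' := by ext1 <;> simp
  map_smul' r k := by ext1 <;> simp

/-- The inclusion `c ↦ ∑ᵢ cᵢ dᵢ` of `D`, as a linear map. -/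
def ofDeg : (Fin n → ℂ) →ₗ[ℂ] ToroidalAlgebra n 𝔤 where
  toFun c := ⟨0, 0, c⟩
  map_add' c c' := by ext1 <;> simp
  map_smul' r c := by ext1 <;> simp

/-- The linear map `x ↦ x(a)`. -/
def eltHom (a : Fin n → ℤ) : 𝔤 →ₗ[ℂ] ToroidalAlgebra n 𝔤 :=
  ofLoop ∘ₗ TensorProduct.mk ℂ (Laurent n) 𝔤 (mono a)

lemma eltHom_apply (a : Fin n → ℤ) (x : 𝔤) : eltHom a x = elt x a :=
  rfl

lemma elt_add (x y : 𝔤) (a : Fin n → ℤ) : elt (x + y) a = elt x a + elt y a :=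
  map_add (eltHom a) x y

lemma elt_smul (r : ℂ) (x : 𝔤) (a : Fin n → ℤ) : elt (r • x) a = r • elt x a :=
  map_smul (eltHom a) r x

lemma elt_zero (a : Fin n → ℤ) : elt (0 : 𝔤) a = 0 :=
  map_zero (eltHom a)

lemma linearMap_ext {V : Type*} [AddCommGroup V] [Module ℂ V]
    {f g : ToroidalAlgebra n 𝔤 →ₗ[ℂ] V} (elt : ∀ x a, f (elt x a) = g (elt x a))
    (central : ∀ a j, f (central a j) = g (central a j)) (der : ∀ i, f (der i) = g (der i)) :
    f = g := by
  have loop : f ∘ₗ ofLoop = g ∘ₗ ofLoop :=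
    TensorProduct.ext (laurent_hom_ext fun a => LinearMap.ext fun x => elt x a)
  have cent : f ∘ₗ ofCent = g ∘ₗ ofCent :=
    Submodule.linearMap_qext _ (LinearMap.pi_ext' fun j => laurent_hom_ext fun a => central a j)
  have deg : f ∘ₗ ofDeg = g ∘ₗ ofDeg :=
    LinearMap.pi_ext' fun i => LinearMap.ext_ring (der i)
  refine LinearMap.ext fun u => ?_
  have hu : u = ofLoop u.loop + ofCent u.cent + ofDeg u.deg := by
    ext1 <;> simp [ofLoop, ofCent, ofDeg]
  rw [hu]
  simp only [map_add]
  exact congrArg₂ _ (congrArg₂ _ (LinearMap.congr_fun loop _) (LinearMap.congr_fun cent _))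
    (LinearMap.congr_fun deg _)

lemma ofDeg_lie_elt (c : Fin n → ℂ) (x : 𝔤) (a : Fin n → ℤ) :
    ⁅(ofDeg c : ToroidalAlgebra n 𝔤), elt x a⁆ = pairing c a • elt x a := by
  ext1 <;> simp [ofDeg, elt, loopElt, degLoop_zero, TensorProduct.smul_tmul']

lemma elt_zero_lie_elt (x y : 𝔤) (b : Fin n → ℤ) :
    ⁅(elt x 0 : ToroidalAlgebra n 𝔤), elt y b⁆ = elt ⁅x, y⁆ b := by
  simp [elt_lie_elt]

lemma sum_smul_central (a : Fin n → ℤ) :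
    ∑ i, (a i : ℂ) • (central a i : ToroidalAlgebra n 𝔤) = 0 := by
  have exact : ∑ i, (a i : ℂ) • tK a i = 0 := by
    have h := formPair_add_swap (mono a) (mono 0)
    simpa [formPair_mono] using h
  have h := congrArg (ofCent (𝔤 := 𝔤)) exact
  simp only [map_sum, map_smul, map_zero] at h
  exact h

lemma elt_lie_elt_zero (x y : 𝔤) (a : Fin n → ℤ) :
    ⁅(elt x a : ToroidalAlgebra n 𝔤), elt y 0⁆ = elt ⁅x, y⁆ a := by
  rw [elt_lie_elt, add_zero, sum_smul_central, smul_zero, add_zero]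

lemma elt_injective (a : Fin n → ℤ) :
    Function.Injective fun x : 𝔤 => (elt x a : ToroidalAlgebra n 𝔤) := by
  have coord (x : 𝔤) : TensorProduct.lid ℂ 𝔤
      (((AddMonoidAlgebra.basis (Fin n → ℤ) ℂ).coord a).rTensor 𝔤 (elt x a).loop) = x := by
    simp [elt, loopElt, mono_eq_basis, -AddMonoidAlgebra.basis_apply]
  exact fun x y h => by rw [← coord x, ← coord y]; exact congrArg _ (congrArg _ (congrArg loop h))

variable (n) in
/-- The decomposition `𝔥̃ₙ = 𝔥 ⊕ D`. -/
def cartanEquiv (𝔥 : LieSubalgebra ℂ 𝔤) : (𝔥 × (Fin n → ℂ)) ≃ₗ[ℂ] cartan n 𝔥 :=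
  LinearEquiv.ofBijective
    (((eltHom 0 ∘ₗ 𝔥.toSubmodule.subtype).coprod ofDeg).codRestrict (cartan n 𝔥).toSubmodule
      fun p => ⟨⟨p.1, p.1.2, add_zero _⟩, add_zero _⟩)
    ⟨by
      rintro ⟨h, c⟩ ⟨h', c'⟩ hp
      have heq : elt (h : 𝔤) 0 + ofDeg c = (elt (h' : 𝔤) 0 + ofDeg c' : ToroidalAlgebra n 𝔤) :=
        congrArg Subtype.val hp
      obtain rfl : c = c' := by simpa [elt, ofDeg] using congrArg deg heq
      exact Prod.ext (Subtype.ext (elt_injective 0 (add_right_cancel heq))) rfl,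
    fun ⟨u, ⟨h, hh, hu⟩, hu'⟩ => ⟨(⟨h, hh⟩, u.deg), Subtype.ext (by
      ext1 <;> simp [eltHom_apply, elt, ofDeg, hu, hu'])⟩⟩

lemma coe_cartanEquiv (𝔥 : LieSubalgebra ℂ 𝔤) (p : 𝔥 × (Fin n → ℂ)) :
    (cartanEquiv n 𝔥 p : ToroidalAlgebra n 𝔤) = elt (p.1 : 𝔤) 0 + ofDeg p.2 :=
  rfl

instance instIsLieAbelianCartan (𝔥 : LieSubalgebra ℂ 𝔤) [IsLieAbelian 𝔥] :
    IsLieAbelian (cartan n 𝔥) where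
  trivial x y := by
    obtain ⟨⟨h, c⟩, rfl⟩ := (cartanEquiv n 𝔥).surjective x
    obtain ⟨⟨h', c'⟩, rfl⟩ := (cartanEquiv n 𝔥).surjective y
    have lie_coe : ⁅(h : 𝔤), (h' : 𝔤)⁆ = 0 := by
      rw [← LieSubalgebra.coe_bracket, trivial_lie_zero, ZeroMemClass.coe_zero]
    have lie_ofDeg : ⁅(ofDeg c : ToroidalAlgebra n 𝔤), (ofDeg c' : ToroidalAlgebra n 𝔤)⁆ = 0 := by
      ext1 <;> simp [ofDeg]
    refine Subtype.ext ?_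
    rw [LieSubalgebra.coe_bracket, coe_cartanEquiv, coe_cartanEquiv, ZeroMemClass.coe_zero,
      add_lie, lie_add, lie_add, elt_zero_lie_elt, ofDeg_lie_elt, lie_ofDeg,
      ← lie_skew (elt _ _) (ofDeg _), ofDeg_lie_elt, lie_coe, elt_zero, pairing_zero_right,
      pairing_zero_right]
    simp only [zero_smul, neg_zero, add_zero]

variable {𝔥 : LieSubalgebra ℂ 𝔤}

/-- The weight of `x(a)` with respect to `𝔥̃ₙ`, for `x` of weight `α` with respect to `𝔥`. -/
def weight (α : Module.Dual ℂ 𝔥) (a : Fin n → ℤ) : Module.Dual ℂ (cartan n 𝔥) :=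
  (α.coprod (Fintype.linearCombination ℂ fun i => (a i : ℂ))) ∘ₗ (cartanEquiv n 𝔥).symm

lemma weight_cartanEquiv (α : Module.Dual ℂ 𝔥) (a : Fin n → ℤ) (p : 𝔥 × (Fin n → ℂ)) :
    weight α a (cartanEquiv n 𝔥 p) = α p.1 + pairing p.2 a := by
  simp [weight, Fintype.linearCombination_apply, pairing]

lemma weight_add (α β : Module.Dual ℂ 𝔥) (a b : Fin n → ℤ) :
    weight (α + β) (a + b) = weight α a + weight β b := by
  refine LinearMap.ext fun y => ?_
  obtain ⟨p, rfl⟩ := (cartanEquiv n 𝔥).surjective y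
  simp only [LinearMap.add_apply, weight_cartanEquiv, pairing_add]
  ring

lemma weight_smul_zero (c : ℂ) (α : Module.Dual ℂ 𝔥) :
    weight (c • α) (0 : Fin n → ℤ) = c • weight α 0 := by
  refine LinearMap.ext fun y => ?_
  obtain ⟨p, rfl⟩ := (cartanEquiv n 𝔥).surjective y
  simp [weight_cartanEquiv, pairing_zero_right]

lemma coe_cartan_lie_elt {α : Module.Dual ℂ 𝔥} {x : 𝔤} (hx : ∀ h : 𝔥, ⁅(h : 𝔤), x⁆ = α h • x)
    (a : Fin n → ℤ) (y : cartan n 𝔥) :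
    ⁅(y : ToroidalAlgebra n 𝔤), elt x a⁆ = weight α a y • elt x a := by
  obtain ⟨p, rfl⟩ := (cartanEquiv n 𝔥).surjective y
  rw [weight_cartanEquiv, coe_cartanEquiv, add_lie, elt_zero_lie_elt, hx, elt_smul,
    ofDeg_lie_elt, add_smul]

end ToroidalAlgebra

section AdaptedCoordinates

open UniversalEnvelopingAlgebra EnvelopingAlgebra

attribute [local instance] LieRing.ofAssociativeRing

lemma exists_basis_zero_eq_and_succ_mem_ker {K V : Type*} [Field K] [AddCommGroup V] [Module K V]
    [FiniteDimensional K V] {φ : Module.Dual K V} {y : V} (hy : φ y ≠ 0) :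
    ∃ (m : ℕ) (v : Module.Basis (Fin (m + 1)) K V), v 0 = y ∧ ∀ j : Fin m, φ (v j.succ) = 0 := by
  refine ⟨_, Module.Basis.mkFinCons y (Module.finBasis K (LinearMap.ker φ))
    (fun c x hx hc => ?_) (fun z => ⟨-(φ z / φ y), ?_⟩), by simp, fun j => by simp⟩
  · simpa [LinearMap.mem_ker.1 hx, hy] using congrArg φ hc
  · simp [LinearMap.mem_ker, hy]

namespace EnvelopingAlgebra

variable {R L : Type*} [CommRing R] [LieRing L] [LieAlgebra R L] [IsLieAbelian L] {m : ℕ}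
  (v : Module.Basis (Fin (m + 1)) R L)

/-- The enveloping algebra of an abelian Lie algebra as an algebra of polynomials in the first
vector of a basis. -/
def equivPolynomial :
    UniversalEnvelopingAlgebra R L ≃ₐ[R] Polynomial (MvPolynomial (Fin m) R) :=
  (equivMvPolynomial v).trans (MvPolynomial.finSuccEquiv R m)

lemma equivPolynomial_ι_zero : equivPolynomial v (ι R (v 0)) = Polynomial.X := by
  rw [equivPolynomial, AlgEquiv.trans_apply, equivMvPolynomial_ι, MvPolynomial.finSuccEquiv_X_zero]

lemma equivPolynomial_ι_succ (j : Fin m) :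
    equivPolynomial v (ι R (v j.succ)) = Polynomial.C (MvPolynomial.X j) := by
  rw [equivPolynomial, AlgEquiv.trans_apply, equivMvPolynomial_ι, MvPolynomial.finSuccEquiv_X_succ]

lemma equivPolynomial_weightShift (χ : Module.Dual R L) (u : UniversalEnvelopingAlgebra R L) :
    equivPolynomial v (weightShift χ u)
      = Polynomial.taylor (MvPolynomial.C (-χ (v 0)) : MvPolynomial (Fin m) R)
        ((equivPolynomial v u).map (translateAlgHom fun j : Fin m => χ (v j.succ)).toRingHom) := by
  have : (equivPolynomial v).toAlgHom.comp (weightShift χ)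
      = ((Polynomial.taylorAlgHom
          (MvPolynomial.C (-χ (v 0)) : MvPolynomial (Fin m) R)).restrictScalars R).comp
        ((Polynomial.mapAlgHom (translateAlgHom fun j : Fin m => χ (v j.succ))).comp
          (equivPolynomial v).toAlgHom) := by
    refine algHom_ext_basis v fun k => ?_
    change equivPolynomial v (weightShift χ (ι R (v k)))
      = Polynomial.taylor _ (Polynomial.map _ (equivPolynomial v (ι R (v k))))
    rw [weightShift_ι, map_sub, AlgEquiv.commutes]
    cases k using Fin.cases with
    | zero =>
      rw [equivPolynomial_ι_zero, Polynomial.map_X, Polynomial.taylor_X]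
      simp [sub_eq_add_neg]
    | succ j =>
      rw [equivPolynomial_ι_succ, Polynomial.map_C, Polynomial.taylor_C]
      simp [translateAlgHom_X]
  exact AlgHom.congr_fun this u

end EnvelopingAlgebra

namespace ToroidalAlgebra

variable {n : ℕ} {𝔤 : Type*} [LieRing 𝔤] [LieAlgebra ℂ 𝔤] {𝔥 : LieSubalgebra ℂ 𝔤} [IsLieAbelian 𝔥]

-- The coordinates other than `h` are chosen in the kernel of `α`, extended by zero to `D`.
lemma exists_algEquiv_polynomial [FiniteDimensional ℂ 𝔥] {α : Module.Dual ℂ 𝔥} {h : 𝔥}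
    (hα : α h = 2) :
    ∃ (m : ℕ) (Φ : UniversalEnvelopingAlgebra ℂ (cartan n 𝔥) ≃ₐ[ℂ]
        Polynomial (MvPolynomial (Fin m) ℂ))
      (τ : (Fin n → ℤ) → MvPolynomial (Fin m) ℂ →+* MvPolynomial (Fin m) ℂ),
      IsTranslationAction τ ∧ Φ (ι ℂ (cartanEquiv n 𝔥 (h, 0))) = Polynomial.X ∧
      ∀ (k : ℤ) (a : Fin n → ℤ) (u : UniversalEnvelopingAlgebra ℂ (cartan n 𝔥)),
        Φ (weightShift (weight (k • α) a) u)
          = Polynomial.taylor ((-2 * k : ℤ) : MvPolynomial (Fin m) ℂ) ((Φ u).map (τ a)) := by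
  have : FiniteDimensional ℂ (cartan n 𝔥) := Module.Finite.equiv (cartanEquiv n 𝔥)
  have weight_h (β : Module.Dual ℂ 𝔥) (a : Fin n → ℤ) :
      weight β a (cartanEquiv n 𝔥 (h, 0)) = β h := by simp [weight_cartanEquiv, Toroidal.pairing]
  obtain ⟨m, v, hv₀, hv⟩ := exists_basis_zero_eq_and_succ_mem_ker
    (φ := weight α (0 : Fin n → ℤ)) (y := cartanEquiv n 𝔥 (h, 0)) (by rw [weight_h, hα]; simp)
  let δ : (Fin n → ℤ) →+ Fin m → ℂ := AddMonoidHom.mk'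
    (fun a j => weight (0 : Module.Dual ℂ 𝔥) a (v j.succ)) fun a b => by
      ext j
      rw [← add_zero (0 : Module.Dual ℂ 𝔥), weight_add, add_zero]
      rfl
  refine ⟨m, equivPolynomial v, _, isTranslationAction_translateAlgHom δ,
    hv₀ ▸ equivPolynomial_ι_zero v, fun k a u => ?_⟩
  have weight_succ (j : Fin m) : weight (k • α) a (v j.succ) = δ a j := by
    have hk : weight (k • α) (0 : Fin n → ℤ) = (k : ℂ) • weight α 0 := by
      rw [← Int.cast_smul_eq_zsmul ℂ, weight_smul_zero]
    rw [← add_zero (k • α), ← zero_add a, weight_add, LinearMap.add_apply, hk,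
      LinearMap.smul_apply, hv, smul_zero, zero_add, zero_add]
    rfl
  have weight_zero : weight (k • α) a (v 0) = 2 * k := by
    rw [hv₀, weight_h, LinearMap.smul_apply, hα, zsmul_eq_mul, mul_comm]
  rw [equivPolynomial_weightShift, weight_zero]
  simp only [weight_succ]
  congr 1
  simp [map_ofNat]

end ToroidalAlgebra

end AdaptedCoordinates

section Invariants

lemma equivFinsuppOfBasisLeft_lTensor {R M N N' I : Type*} [CommRing R] [AddCommGroup M]
    [Module R M] [AddCommGroup N] [Module R N] [AddCommGroup N'] [Module R N'] [DecidableEq I]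
    (b : Module.Basis I R M) (f : N →ₗ[R] N') (t : M ⊗[R] N) (i : I) :
    TensorProduct.equivFinsuppOfBasisLeft b (f.lTensor M t) i
      = f (TensorProduct.equivFinsuppOfBasisLeft b t i) := by
  induction t using TensorProduct.induction_on with
  | zero => simp
  | add t t' ht ht' => simp only [map_add, Finsupp.add_apply, ht, ht']
  | tmul m p => simp

variable {K V κ : Type*} [Field K] [CharZero K] [AddCommGroup V] [Module K V]

lemma exists_eq_tmul_one_of_forall_lTensor_translateAlgHom_eq {t : V ⊗[K] MvPolynomial κ K}
    (ht : ∀ a : κ → ℤ, (translateAlgHom fun j => (a j : K)).toLinearMap.lTensor V t = t) :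
    ∃ v : V, t = v ⊗ₜ 1 := by
  classical
  let b := Module.Basis.ofVectorSpace K V
  let evalZero : MvPolynomial κ K →ₗ[K] K := (MvPolynomial.aeval 0).toLinearMap
  have constant (i) : TensorProduct.equivFinsuppOfBasisLeft b t i
      = algebraMap K _ (evalZero (TensorProduct.equivFinsuppOfBasisLeft b t i)) :=
    eq_C_of_forall_translateAlgHom_intCast_eq fun a : κ → ℤ => by
      conv_rhs => rw [← ht a, equivFinsuppOfBasisLeft_lTensor]
      rfl
  have key : (Algebra.linearMap K (MvPolynomial κ K) ∘ₗ evalZero).lTensor V t = t :=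
    (TensorProduct.equivFinsuppOfBasisLeft b).injective <| Finsupp.ext fun i =>
      (equivFinsuppOfBasisLeft_lTensor b _ t i).trans (constant i).symm
  obtain ⟨v, hv⟩ := (TensorProduct.rid K V).symm.surjective (evalZero.lTensor V t)
  refine ⟨v, ?_⟩
  rw [← key, LinearMap.lTensor_comp_apply, ← hv]
  simp

end Invariants

namespace ToroidalAlgebra

open Toroidal UniversalEnvelopingAlgebra EnvelopingAlgebra

variable {n : ℕ} {𝔤 : Type*} [LieRing 𝔤] [LieAlgebra ℂ 𝔤] {𝔥 : LieSubalgebra ℂ 𝔤} [IsLieAbelian 𝔥]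

attribute [local instance] LieRing.ofAssociativeRing

variable (n 𝔥) in
/-- The inclusion `U(𝔥) → U(𝔥̃ₙ)`. -/
def inclU : UniversalEnvelopingAlgebra ℂ 𝔥 →ₐ[ℂ] UniversalEnvelopingAlgebra ℂ (cartan n 𝔥) :=
  liftLinear ((ι ℂ : cartan n 𝔥 →ₗ⁅ℂ⁆ _).toLinearMap ∘ₗ (cartanEquiv n 𝔥).toLinearMap ∘ₗ
    LinearMap.inl ℂ 𝔥 (Fin n → ℂ))

lemma inclU_ι (h : 𝔥) : inclU n 𝔥 (ι ℂ h) = ι ℂ (cartanEquiv n 𝔥 (h, 0)) := by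
  rw [inclU, liftLinear_ι]
  rfl

variable (n 𝔥) in
/-- The inclusion `ℂ[d₁, …, dₙ] → U(𝔥̃ₙ)`. -/
def inclPD : PD n →ₐ[ℂ] UniversalEnvelopingAlgebra ℂ (cartan n 𝔥) :=
  MvPolynomial.aeval fun i => ι ℂ (cartanEquiv n 𝔥 (0, Pi.single i 1))

lemma inclPD_X (i : Fin n) :
    inclPD n 𝔥 (MvPolynomial.X i) = ι ℂ (cartanEquiv n 𝔥 (0, Pi.single i 1)) :=
  MvPolynomial.aeval_X _ _

lemma degPoly_single (i : Fin n) : degPoly n (Pi.single i 1) = MvPolynomial.X i := by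
  simp [degPoly, Pi.single_apply]

lemma inclPD_degPoly (c : Fin n → ℂ) :
    inclPD n 𝔥 (degPoly n c) = ι ℂ (cartanEquiv n 𝔥 (0, c)) := by
  have : (inclPD n 𝔥).toLinearMap ∘ₗ degPoly n = (ι ℂ : cartan n 𝔥 →ₗ⁅ℂ⁆ _).toLinearMap ∘ₗ
      (cartanEquiv n 𝔥).toLinearMap ∘ₗ LinearMap.inr ℂ 𝔥 (Fin n → ℂ) := by
    refine LinearMap.pi_ext' fun i => LinearMap.ext_ring ?_
    simp only [LinearMap.comp_apply, LinearMap.single_apply, AlgHom.toLinearMap_apply]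
    rw [degPoly_single, inclPD_X]
    rfl
  exact LinearMap.congr_fun this c

variable (n 𝔥) in
/-- The map `U(𝔥̃ₙ) → U(𝔥) ⊗ ℂ[d₁, …, dₙ]` with `h + c ↦ h ⊗ 1 + 1 ⊗ c`. -/
def tensorInv :
    UniversalEnvelopingAlgebra ℂ (cartan n 𝔥) →ₐ[ℂ] UniversalEnvelopingAlgebra ℂ 𝔥 ⊗[ℂ] PD n :=
  liftLinear (LinearMap.coprod
      ((TensorProduct.mk ℂ _ _).flip 1 ∘ₗ (ι ℂ : 𝔥 →ₗ⁅ℂ⁆ _).toLinearMap)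
      (TensorProduct.mk ℂ _ _ 1 ∘ₗ degPoly n) ∘ₗ (cartanEquiv n 𝔥).symm.toLinearMap)

lemma tensorInv_ι (p : 𝔥 × (Fin n → ℂ)) :
    tensorInv n 𝔥 (ι ℂ (cartanEquiv n 𝔥 p)) = ι ℂ p.1 ⊗ₜ 1 + 1 ⊗ₜ degPoly n p.2 := by
  rw [tensorInv, liftLinear_ι, LinearMap.comp_apply, LinearEquiv.coe_coe,
    LinearEquiv.symm_apply_apply]
  rfl

variable (n 𝔥) in
/-- The decomposition `U(𝔥̃ₙ) = U(𝔥) ⊗ ℂ[d₁, …, dₙ]`. -/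
def tensorEquiv :
    UniversalEnvelopingAlgebra ℂ 𝔥 ⊗[ℂ] PD n ≃ₐ[ℂ] UniversalEnvelopingAlgebra ℂ (cartan n 𝔥) :=
  AlgEquiv.ofAlgHom (Algebra.TensorProduct.productMap (inclU n 𝔥) (inclPD n 𝔥)) (tensorInv n 𝔥)
    (algHom_ext fun y => by
      obtain ⟨⟨h, c⟩, rfl⟩ := (cartanEquiv n 𝔥).surjective y
      rw [AlgHom.comp_apply, AlgHom.id_apply, tensorInv_ι, map_add,
        Algebra.TensorProduct.productMap_apply_tmul, Algebra.TensorProduct.productMap_apply_tmul,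
        map_one, map_one, mul_one, one_mul, inclPD_degPoly, inclU_ι, ← map_add, ← map_add,
        Prod.mk_add_mk, add_zero, zero_add])
    (Algebra.TensorProduct.ext
      (algHom_ext fun h => by
        rw [AlgHom.comp_apply, AlgHom.comp_apply, Algebra.TensorProduct.includeLeft_apply,
          Algebra.TensorProduct.productMap_apply_tmul, map_one, mul_one, inclU_ι, tensorInv_ι,
          map_zero, TensorProduct.tmul_zero, add_zero]
        rfl)
      (MvPolynomial.algHom_ext fun i => by
        change tensorInv n 𝔥 (Algebra.TensorProduct.productMap _ _ (1 ⊗ₜ MvPolynomial.X i))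
          = 1 ⊗ₜ MvPolynomial.X i
        rw [Algebra.TensorProduct.productMap_apply_tmul, map_one, one_mul, inclPD_X, tensorInv_ι,
          degPoly_single, map_zero, TensorProduct.zero_tmul, zero_add]))

lemma tensorEquiv_tmul (v : UniversalEnvelopingAlgebra ℂ 𝔥) (p : PD n) :
    tensorEquiv n 𝔥 (v ⊗ₜ p) = inclU n 𝔥 v * inclPD n 𝔥 p :=
  rfl

lemma weightShift_weight_inclPD (α : Module.Dual ℂ 𝔥) (a : Fin n → ℤ) (p : PD n) :
    weightShift (weight α a) (inclPD n 𝔥 p) = inclPD n 𝔥 (shift a p) := by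
  have : (weightShift (weight α a)).comp (inclPD n 𝔥) = (inclPD n 𝔥).comp (shift a) := by
    refine MvPolynomial.algHom_ext fun i => ?_
    simp only [AlgHom.comp_apply, inclPD_X, weightShift_ι, weight_cartanEquiv, shift_X, map_sub,
      map_zero, zero_add, pairing_single]
    rw [← MvPolynomial.algebraMap_eq, AlgHom.commutes]
  exact AlgHom.congr_fun this p

lemma weightShift_weight_inclU (α : Module.Dual ℂ 𝔥) (a : Fin n → ℤ)
    (v : UniversalEnvelopingAlgebra ℂ 𝔥) :
    weightShift (weight α a) (inclU n 𝔥 v) = inclU n 𝔥 (weightShift α v) := by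
  have : (weightShift (weight α a)).comp (inclU n 𝔥) = (inclU n 𝔥).comp (weightShift α) := by
    refine algHom_ext fun h => ?_
    rw [AlgHom.comp_apply, AlgHom.comp_apply, inclU_ι, weightShift_ι, weight_cartanEquiv,
      weightShift_ι, map_sub, AlgHom.commutes, inclU_ι]
    simp [pairing]
  exact AlgHom.congr_fun this v

lemma mem_range_inclU {u : UniversalEnvelopingAlgebra ℂ (cartan n 𝔥)}
    (hu : ∀ a, weightShift (weight (0 : Module.Dual ℂ 𝔥) a) u = u) : u ∈ (inclU n 𝔥).range := by
  obtain ⟨t, rfl⟩ := (tensorEquiv n 𝔥).surjective u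
  have intertwine (a : Fin n → ℤ) :
      (weightShift (weight (0 : Module.Dual ℂ 𝔥) a)).toLinearMap ∘ₗ (tensorEquiv n 𝔥).toLinearMap
        = (tensorEquiv n 𝔥).toLinearMap ∘ₗ (shift a).toLinearMap.lTensor _ := by
    refine TensorProduct.ext' fun v p => ?_
    change weightShift _ (tensorEquiv n 𝔥 (v ⊗ₜ p)) = tensorEquiv n 𝔥 (v ⊗ₜ shift a p)
    rw [tensorEquiv_tmul, tensorEquiv_tmul, map_mul, weightShift_weight_inclU,
      weightShift_weight_inclPD, weightShift_zero, AlgHom.id_apply]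
  obtain ⟨v, rfl⟩ := exists_eq_tmul_one_of_forall_lTensor_translateAlgHom_eq fun a =>
    (tensorEquiv n 𝔥).injective ((LinearMap.congr_fun (intertwine a) t).symm.trans (hu a))
  exact ⟨v, by rw [tensorEquiv_tmul, map_one, mul_one]; rfl⟩

end ToroidalAlgebra

namespace TildeModule

open Toroidal UniversalEnvelopingAlgebra EnvelopingAlgebra ToroidalAlgebra

variable {n : ℕ} {𝔤 : Type*} [LieRing 𝔤] [LieAlgebra ℂ 𝔤] {𝔥 : LieSubalgebra ℂ 𝔤}
  (lam : Fin n → ℂˣ) (M : Type*) [AddCommGroup M] [Module ℂ M]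

variable {lam M} in
lemma linearMap_ext {V : Type*} [AddCommGroup V] [Module ℂ V] {f g : TildeModule lam M →ₗ[ℂ] V}
    (h : ∀ v p, f (mk lam M v p) = g (mk lam M v p)) : f = g :=
  TensorProduct.ext' h

variable [LieRingModule 𝔤 M] [LieModule ℂ 𝔤 M]

lemma elt_zero_lie_mk (x : 𝔤) (v : M) (p : PD n) :
    ⁅(elt x 0 : ToroidalAlgebra n 𝔤), mk lam M v p⁆ = mk lam M ⁅x, v⁆ p := by
  have shift_zero : shift (0 : Fin n → ℤ) = AlgHom.id ℂ (PD n) :=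
    MvPolynomial.algHom_ext fun i => by simp [shift_X]
  rw [elt_lie_mk, shift_zero]
  simp [monoVal]

lemma ofDeg_lie_mk (c : Fin n → ℂ) (v : M) (p : PD n) :
    ⁅(ofDeg c : ToroidalAlgebra n 𝔤), mk lam M v p⁆ = mk lam M v (degPoly n c * p) := by
  change act lam M _ (v ⊗ₜ[ℂ] p) = v ⊗ₜ[ℂ] (degPoly n c * p)
  simp [act_apply, ofDeg]

attribute [local instance] LieRing.ofAssociativeRing in
lemma isFreeRankOne [IsLieAbelian 𝔥] (h : IsFreeRankOne 𝔥 M) :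
    IsFreeRankOne (cartan n 𝔥) (TildeModule lam M) := by
  obtain ⟨e, he⟩ := h
  have map_lie (x : 𝔥) (v : M) : e ⁅(x : 𝔤), v⁆ = ι ℂ x * e v := by
    rw [← he, lift_ι_apply]
    rfl
  let E : TildeModule lam M ≃ₗ[ℂ] UniversalEnvelopingAlgebra ℂ (cartan n 𝔥) :=
    (TensorProduct.congr e (LinearEquiv.refl ℂ (PD n))).trans (tensorEquiv n 𝔥).toLinearEquiv
  have E_mk (v p) : E (mk lam M v p) = inclU n 𝔥 (e v) * inclPD n 𝔥 p := rfl
  refine ⟨E, apply_act_eq_mul E.toLinearMap fun x w => ?_⟩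
  obtain ⟨⟨h, c⟩, rfl⟩ := (cartanEquiv n 𝔥).surjective x
  have split : ι ℂ (cartanEquiv n 𝔥 (h, c)) = inclU n 𝔥 (ι ℂ h) + inclPD n 𝔥 (degPoly n c) := by
    rw [inclU_ι, inclPD_degPoly, ← map_add, ← map_add, Prod.mk_add_mk, add_zero, zero_add]
  have : E.toLinearMap ∘ₗ LieModule.toEnd ℂ (ToroidalAlgebra n 𝔤) (TildeModule lam M)
      (cartanEquiv n 𝔥 (h, c)) = LinearMap.mulLeft ℂ (ι ℂ (cartanEquiv n 𝔥 (h, c))) ∘ₗ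
        E.toLinearMap := by
    refine linearMap_ext fun v p => ?_
    change E ⁅(cartanEquiv n 𝔥 (h, c) : ToroidalAlgebra n 𝔤), mk lam M v p⁆
      = ι ℂ (cartanEquiv n 𝔥 (h, c)) * E (mk lam M v p)
    rw [coe_cartanEquiv, add_lie, elt_zero_lie_mk, ofDeg_lie_mk, map_add, E_mk, E_mk, E_mk, map_lie,
      split, map_mul, map_mul]
    ring
  exact LinearMap.congr_fun this w

end TildeModule

section Symbol

namespace EnvelopingAlgebra

open UniversalEnvelopingAlgebra

variable {R L : Type*} [CommRing R] [LieRing L] [LieAlgebra R L] {H : LieSubalgebra R L}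
  {N : Type*} [AddCommGroup N] [Module R N] [LieRingModule L N] [LieModule R L N]

attribute [local instance] LieRing.ofAssociativeRing

/-- The element of `U(H)` by which `x` acts on the generator `e⁻¹(1)` of a module that is free of
rank one over `U(H)`. -/
def symbol (e : N ≃ₗ[R] UniversalEnvelopingAlgebra R H) :
    L →ₗ[R] UniversalEnvelopingAlgebra R H :=
  e.toLinearMap ∘ₗ (LieModule.toEnd R L N : L →ₗ[R] Module.End R N).flip (e.symm 1)

variable {e : N ≃ₗ[R] UniversalEnvelopingAlgebra R H}

lemma symbol_apply (x : L) : symbol e x = e ⁅x, e.symm 1⁆ :=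
  rfl

variable (he : ∀ u v, e (act H N u v) = u * e v)
include he

lemma symbol_coe (y : H) : symbol e (y : L) = ι R y := by
  rw [symbol_apply, ← act_ι, he, e.apply_symm_apply, mul_one]

variable [IsLieAbelian H] {x y : L} {χ ψ : Module.Dual R H}

lemma apply_lie_eq_weightShift_mul_symbol (hx : ∀ z : H, ⁅(z : L), x⁆ = χ z • x) (v : N) :
    e ⁅x, v⁆ = weightShift χ (e v) * symbol e x := by
  have generated : act H N (e v) (e.symm 1) = v :=
    e.injective (by rw [he, e.apply_symm_apply, mul_one])
  rw [symbol_apply, ← he, ← lie_act hx, generated]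

lemma symbol_lie (hx : ∀ z : H, ⁅(z : L), x⁆ = χ z • x) (hy : ∀ z : H, ⁅(z : L), y⁆ = ψ z • y) :
    symbol e ⁅x, y⁆
      = weightShift χ (symbol e y) * symbol e x - weightShift ψ (symbol e x) * symbol e y := by
  rw [symbol_apply ⁅x, y⁆, lie_lie, map_sub,
    apply_lie_eq_weightShift_mul_symbol he hx ⁅y, e.symm 1⁆,
    apply_lie_eq_weightShift_mul_symbol he hy ⁅x, e.symm 1⁆]
  rfl

end EnvelopingAlgebra

end Symbol

section Characters

open Toroidal

variable {n : ℕ}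

lemma exists_monoVal_eq (r : (Fin n → ℤ) → ℂˣ) (hr : ∀ a b, r (a + b) = r a * r b) :
    ∃ lam : Fin n → ℂˣ, ∀ a, r a = monoVal lam a := by
  let f : (Fin n → ℤ) →+ Additive ℂˣ :=
    AddMonoidHom.mk' (fun a => Additive.ofMul (r a)) fun a b => by rw [hr]; rfl
  refine ⟨fun i => r (Pi.single i 1), fun a => ?_⟩
  have ha : a = ∑ i, a i • Pi.single i (1 : ℤ) := by
    ext j
    simp [Finset.sum_apply, Pi.single_apply]
  have hf : f a = ∑ i, a i • f (Pi.single i 1) := by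
    conv_lhs => rw [ha]
    simp only [map_sum, map_zsmul]
  exact (congrArg Additive.toMul hf).trans (toMul_sum _ _)

lemma exists_C_monoVal_eq {κ : Type*} (r : (Fin n → ℤ) → (MvPolynomial κ ℂ)ˣ)
    (hr : ∀ a b, r (a + b) = r a * r b) :
    ∃ lam : Fin n → ℂˣ, ∀ a, (r a : MvPolynomial κ ℂ) = MvPolynomial.C (monoVal lam a : ℂ) := by
  obtain ⟨lam, hlam⟩ := exists_monoVal_eq
    (fun a => Units.map (MvPolynomial.constantCoeff : MvPolynomial κ ℂ →+* ℂ).toMonoidHom (r a))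
    fun a b => by rw [hr, map_mul]
  refine ⟨lam, fun a => ?_⟩
  obtain ⟨c, -, hc⟩ := MvPolynomial.isUnit_iff_eq_C_of_isReduced.1 (r a).isUnit
  rw [← hlam]
  simp [hc]

end Characters

lemma killingForm_eq_zero_of_lie_eq_smul {K L : Type*} [Field K] [LieRing L] [LieAlgebra K L]
    {h x : L} {c : K} (hc : c ≠ 0) (hx : ⁅h, x⁆ = c • x) : killingForm K L h x = 0 := by
  have key := LieModule.traceForm_apply_lie_apply K L L h h x
  rw [lie_self, hx, map_zero, LinearMap.zero_apply, map_smul, smul_eq_mul, eq_comm,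
    mul_eq_zero] at key
  exact key.resolve_left hc

namespace ToroidalAlgebra

open Toroidal UniversalEnvelopingAlgebra EnvelopingAlgebra

variable {n : ℕ} {𝔤 : Type*} [LieRing 𝔤] [LieAlgebra ℂ 𝔤] {𝔥 : LieSubalgebra ℂ 𝔤} [IsLieAbelian 𝔥]
  {N : Type*} [AddCommGroup N] [Module ℂ N] [LieRingModule (ToroidalAlgebra n 𝔤) N]
  [LieModule ℂ (ToroidalAlgebra n 𝔤) N]

lemma elt_lie_elt_of_lie_eq_smul {h x : 𝔤} {c : ℂ} (hc : c ≠ 0) (hx : ⁅h, x⁆ = c • x)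
    (a b : Fin n → ℤ) :
    ⁅(elt h a : ToroidalAlgebra n 𝔤), elt x b⁆ = c • elt x (a + b) := by
  rw [elt_lie_elt, killingForm_eq_zero_of_lie_eq_smul hc hx, zero_smul, add_zero, hx, elt_smul]

attribute [local instance] LieRing.ofAssociativeRing

variable {e : N ≃ₗ[ℂ] UniversalEnvelopingAlgebra ℂ (cartan n 𝔥)}
  (he : ∀ u v, e (act (cartan n 𝔥) N u v) = u * e v)
include he

section Coordinates

variable {m : ℕ} {α : Module.Dual ℂ 𝔥}
  {Φ : UniversalEnvelopingAlgebra ℂ (cartan n 𝔥) ≃ₐ[ℂ] Polynomial (MvPolynomial (Fin m) ℂ)}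
  {τ : (Fin n → ℤ) → MvPolynomial (Fin m) ℂ →+* MvPolynomial (Fin m) ℂ}
  (hΦ : ∀ (k : ℤ) (a : Fin n → ℤ) (u : UniversalEnvelopingAlgebra ℂ (cartan n 𝔥)),
    Φ (weightShift (weight (k • α) a) u)
      = Polynomial.taylor ((-2 * k : ℤ) : MvPolynomial (Fin m) ℂ) ((Φ u).map (τ a)))
include hΦ

lemma map_symbol_elt_lie_elt {x y : 𝔤} {k l : ℤ} (hx : ∀ z : 𝔥, ⁅(z : 𝔤), x⁆ = (k • α) z • x)
    (hy : ∀ z : 𝔥, ⁅(z : 𝔤), y⁆ = (l • α) z • y) (a b : Fin n → ℤ) :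
    Φ (symbol e ⁅(elt x a : ToroidalAlgebra n 𝔤), elt y b⁆)
      = Φ (symbol e (elt x a)) * Polynomial.taylor ((-2 * k : ℤ) : MvPolynomial (Fin m) ℂ)
          ((Φ (symbol e (elt y b))).map (τ a))
        - Φ (symbol e (elt y b)) * Polynomial.taylor ((-2 * l : ℤ) : MvPolynomial (Fin m) ℂ)
          ((Φ (symbol e (elt x a))).map (τ b)) := by
  rw [symbol_lie he (coe_cartan_lie_elt hx a) (coe_cartan_lie_elt hy b), map_sub, map_mul, map_mul,
    hΦ, hΦ, mul_comm, mul_comm (Polynomial.taylor _ _) (Φ (symbol e (elt y b)))]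

lemma loopSl2System_symbol {h : 𝔥} {x y : 𝔤} (hτ : IsTranslationAction τ)
    (hΦh : Φ (ι ℂ (cartanEquiv n 𝔥 (h, 0))) = Polynomial.X) (t : IsSl2Triple (h : 𝔤) x y)
    (hx : ∀ k : 𝔥, ⁅(k : 𝔤), x⁆ = α k • x) (hy : ∀ k : 𝔥, ⁅(k : 𝔤), y⁆ = -α k • y) :
    LoopSl2System τ (fun a => Φ (symbol e (elt x a))) (fun a => Φ (symbol e (elt y a)))
      (fun a => Φ (symbol e (elt (h : 𝔤) a))) := by
  have lie_h_x : ⁅(h : 𝔤), x⁆ = (2 : ℂ) • x := by rw [t.lie_h_e_nsmul, two_smul, two_smul]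
  have lie_h_y : ⁅(h : 𝔤), y⁆ = (-2 : ℂ) • y := by
    rw [t.lie_h_f_nsmul, neg_smul, two_smul, two_smul]
  have weight_x (k : 𝔥) : ⁅(k : 𝔤), x⁆ = ((1 : ℤ) • α) k • x := by rw [one_smul, hx]
  have weight_y (k : 𝔥) : ⁅(k : 𝔤), y⁆ = ((-1 : ℤ) • α) k • y := by
    rw [neg_one_smul, LinearMap.neg_apply, hy]
  have weight_h (k : 𝔥) : ⁅(k : 𝔤), (h : 𝔤)⁆ = ((0 : ℤ) • α) k • (h : 𝔤) := by
    rw [← LieSubalgebra.coe_bracket, trivial_lie_zero]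
    simp
  refine ⟨?_, fun a b => ?_, fun a b => ?_, fun a => ?_, fun a => ?_, fun a => ?_⟩
  · have coe : (cartanEquiv n 𝔥 (h, 0) : ToroidalAlgebra n 𝔤) = elt (h : 𝔤) 0 := by
      rw [coe_cartanEquiv, map_zero, add_zero]
    rw [← coe, symbol_coe he, hΦh]
  · have := map_symbol_elt_lie_elt he hΦ weight_h weight_x a b
    rw [elt_lie_elt_of_lie_eq_smul two_ne_zero lie_h_x, map_smul, map_smul, two_smul,
      ← two_mul] at this
    simpa using this.symm
  · have := map_symbol_elt_lie_elt he hΦ weight_h weight_y a b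
    rw [elt_lie_elt_of_lie_eq_smul (by norm_num) lie_h_y, map_smul, map_smul, neg_smul, two_smul,
      ← two_mul] at this
    simpa using this.symm
  · have := map_symbol_elt_lie_elt he hΦ weight_x weight_y a 0
    rw [elt_lie_elt_zero, t.lie_e_f, hτ.map_zero, Polynomial.map_id] at this
    simpa using this.symm
  · have := map_symbol_elt_lie_elt he hΦ weight_x weight_x a 0
    rw [elt_lie_elt_zero, lie_self, elt_zero, map_zero, map_zero, hτ.map_zero, Polynomial.map_id,
      eq_comm, sub_eq_zero] at this
    simpa using this
  · have := map_symbol_elt_lie_elt he hΦ weight_y weight_y a 0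
    rw [elt_lie_elt_zero, lie_self, elt_zero, map_zero, map_zero, hτ.map_zero, Polynomial.map_id,
      eq_comm, sub_eq_zero] at this
    simpa using this

omit he in
lemma mem_range_inclU_of_map_eq {u : UniversalEnvelopingAlgebra ℂ (cartan n 𝔥)}
    (hu : ∀ a, (Φ u).map (τ a) = Φ u) : u ∈ (inclU n 𝔥).range :=
  mem_range_inclU fun a => Φ.injective <| by
    rw [← zero_smul ℤ α, hΦ, hu]
    simp

end Coordinates

theorem exists_symbol_elt_eq_monoVal_smul [FiniteDimensional ℂ 𝔥] {α : Module.Dual ℂ 𝔥} {h : 𝔥}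
    {x y : 𝔤} (t : IsSl2Triple (h : 𝔤) x y) (hx : ∀ k : 𝔥, ⁅(k : 𝔤), x⁆ = α k • x)
    (hy : ∀ k : 𝔥, ⁅(k : 𝔤), y⁆ = -α k • y) :
    symbol e (elt x 0) ∈ (inclU n 𝔥).range ∧ symbol e (elt y 0) ∈ (inclU n 𝔥).range ∧
      ∃ lam : Fin n → ℂˣ, ∀ a, symbol e (elt x a) = (monoVal lam a : ℂ) • symbol e (elt x 0) := by
  have hα : α h = 2 := by
    refine smul_left_injective ℂ t.e_ne_zero ?_
    change α h • x = (2 : ℂ) • x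
    rw [← hx, t.lie_h_e_nsmul, two_smul, two_smul]
  obtain ⟨m, Φ, τ, hτ, hΦh, hΦ⟩ := exists_algEquiv_polynomial (n := n) hα
  have S := loopSl2System_symbol he hΦ hτ hΦh t hx hy
  obtain ⟨r, hr, hE⟩ := S.exists_character hτ
  obtain ⟨lam, hlam⟩ := exists_C_monoVal_eq r hr
  refine ⟨mem_range_inclU_of_map_eq hΦ (S.map_e_zero hτ),
    mem_range_inclU_of_map_eq hΦ (S.map_f_zero hτ), lam, fun a => Φ.injective ?_⟩
  rw [hE, hlam, map_smul, Algebra.smul_def]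
  rfl

end ToroidalAlgebra

section EvaluationSubspace

open Toroidal

namespace ToroidalAlgebra

variable {n : ℕ} {𝔤 : Type*} [LieRing 𝔤] [LieAlgebra ℂ 𝔤]
  {N : Type*} [AddCommGroup N] [Module ℂ N] [LieRingModule (ToroidalAlgebra n 𝔤) N]
  [LieModule ℂ (ToroidalAlgebra n 𝔤) N]

attribute [local instance] LieRing.ofAssociativeRing

/-- A subspace `W` of a `𝔤̃ₙ`-module on which the loop algebra acts like an evaluation module:
`W` is stable under `𝔤`, and `x(a)` acts on it as `λ^a x`. -/
structure IsEvaluationSubspace (lam : Fin n → ℂˣ) (𝔤 : Type*) [LieRing 𝔤] [LieAlgebra ℂ 𝔤]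
    {N : Type*} [AddCommGroup N] [Module ℂ N] [LieRingModule (ToroidalAlgebra n 𝔤) N]
    (W : Submodule ℂ N) : Prop where
  lie_mem : ∀ (x : 𝔤), ∀ w ∈ W, ⁅(elt x 0 : ToroidalAlgebra n 𝔤), w⁆ ∈ W
  elt_lie : ∀ (x : 𝔤) (a : Fin n → ℤ), ∀ w ∈ W, ⁅(elt x a : ToroidalAlgebra n 𝔤), w⁆
    = (monoVal lam a : ℂ) • ⁅(elt x 0 : ToroidalAlgebra n 𝔤), w⁆

lemma elt_zero_lie_mem_of_lieSpan_eq_top {W : Submodule ℂ N} {s : Set 𝔤}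
    (span : LieSubalgebra.lieSpan ℂ 𝔤 s = ⊤)
    (hs : ∀ x ∈ s, ∀ w ∈ W, ⁅(elt x 0 : ToroidalAlgebra n 𝔤), w⁆ ∈ W) (x : 𝔤) :
    ∀ w ∈ W, ⁅(elt x 0 : ToroidalAlgebra n 𝔤), w⁆ ∈ W := by
  let S : LieSubalgebra ℂ 𝔤 :=
    { carrier := {x | ∀ w ∈ W, ⁅(elt x 0 : ToroidalAlgebra n 𝔤), w⁆ ∈ W}
      zero_mem' w _ := by rw [elt_zero, zero_lie]; exact W.zero_mem
      add_mem' hx hy w hw := by rw [elt_add, add_lie]; exact W.add_mem (hx w hw) (hy w hw)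
      smul_mem' r x hx w hw := by rw [elt_smul, smul_lie]; exact W.smul_mem r (hx w hw)
      lie_mem' hx hy w hw := by
        rw [← elt_lie_elt_zero, lie_lie]
        exact W.sub_mem (hx _ (hy w hw)) (hy _ (hx w hw)) }
  have : S = ⊤ := eq_top_iff.2 (span ▸ LieSubalgebra.lieSpan_le.2 hs)
  exact (this ▸ LieSubalgebra.mem_top x : x ∈ S)

lemma isEvaluationSubspace_of_ne_zero [LieAlgebra.IsSimple ℂ 𝔤] {lam : Fin n → ℂˣ}
    {W : Submodule ℂ N} (lie_mem : ∀ (x : 𝔤), ∀ w ∈ W, ⁅(elt x 0 : ToroidalAlgebra n 𝔤), w⁆ ∈ W)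
    {x : 𝔤} (x_ne_zero : x ≠ 0) (elt_lie : ∀ a, ∀ w ∈ W, ⁅(elt x a : ToroidalAlgebra n 𝔤), w⁆
      = (monoVal lam a : ℂ) • ⁅(elt x 0 : ToroidalAlgebra n 𝔤), w⁆) :
    IsEvaluationSubspace lam 𝔤 W := by
  let I : LieIdeal ℂ 𝔤 :=
    { carrier := {x | ∀ a, ∀ w ∈ W, ⁅(elt x a : ToroidalAlgebra n 𝔤), w⁆
        = (monoVal lam a : ℂ) • ⁅(elt x 0 : ToroidalAlgebra n 𝔤), w⁆}
      zero_mem' a w _ := by simp only [elt_zero, zero_lie, smul_zero]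
      add_mem' hx hy a w hw := by simp only [elt_add, add_lie, hx a w hw, hy a w hw, smul_add]
      smul_mem' r x hx a w hw := by
        rw [elt_smul, elt_smul, smul_lie, smul_lie, hx a w hw, smul_comm]
      lie_mem {y x} hx a w hw := by
        rw [← elt_zero_lie_elt, ← elt_zero_lie_elt, lie_lie, lie_lie, hx a w hw,
          hx a _ (lie_mem y w hw), lie_smul, smul_sub] }
  have x_mem : x ∈ I := elt_lie
  have I_ne_bot : I ≠ ⊥ := fun h => x_ne_zero ((LieSubmodule.mem_bot x).1 (h ▸ x_mem))
  have I_eq_top : I = ⊤ := (LieAlgebra.IsSimple.eq_bot_or_eq_top I).resolve_left I_ne_bot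
  exact ⟨lie_mem, fun y => (I_eq_top ▸ LieSubmodule.mem_top y : y ∈ I)⟩

namespace IsEvaluationSubspace

variable {lam : Fin n → ℂˣ} {W : Submodule ℂ N} (hW : IsEvaluationSubspace lam 𝔤 W)
include hW

lemma elt_lie_elt_lie (x y : 𝔤) (a c : Fin n → ℤ) {w : N} (hw : w ∈ W) :
    ⁅(elt x a : ToroidalAlgebra n 𝔤), ⁅(elt y c : ToroidalAlgebra n 𝔤), w⁆⁆
      = (monoVal lam (a + c) : ℂ) •
        ⁅(elt x 0 : ToroidalAlgebra n 𝔤), ⁅(elt y 0 : ToroidalAlgebra n 𝔤), w⁆⁆ := by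
  rw [hW.elt_lie y c w hw, lie_smul, hW.elt_lie x a _ (hW.lie_mem y w hw), smul_smul, monoVal_add,
    Units.val_mul, mul_comm]

lemma central_lie_eq_zero {x y : 𝔤} (hxy : killingForm ℂ 𝔤 x y ≠ 0) (m : Fin n → ℤ) (j : Fin n)
    {w : N} (hw : w ∈ W) : ⁅(central m j : ToroidalAlgebra n 𝔤), w⁆ = 0 := by
  have sum_central (a c : Fin n → ℤ) :
      ⁅(∑ i, (a i : ℂ) • central (a + c) i : ToroidalAlgebra n 𝔤), w⁆ = 0 := by
    have bracket := congrArg (⁅·, w⁆) (elt_lie_elt x y a c)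
    beta_reduce at bracket
    rw [add_lie, smul_lie, lie_lie, hW.elt_lie_elt_lie x y a c hw, hW.elt_lie_elt_lie y x c a hw,
      add_comm c a, ← smul_sub, ← lie_lie, elt_lie_elt_zero, hW.elt_lie _ (a + c) w hw,
      left_eq_add, smul_eq_zero] at bracket
    exact bracket.resolve_left hxy
  have := sum_central (Pi.single j 1) (m - Pi.single j 1)
  rw [add_sub_cancel] at this
  simpa [Pi.single_apply] using this

/-- The action of `𝔤` on an evaluation subspace. -/
def toEnd : 𝔤 →ₗ⁅ℂ⁆ Module.End ℂ W where
  toFun x := (LieModule.toEnd ℂ (ToroidalAlgebra n 𝔤) N (elt x 0)).restrict (hW.lie_mem x)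
  map_add' x y := LinearMap.ext fun w => Subtype.ext <|
    (congrArg (⁅·, (w : N)⁆) (elt_add x y 0)).trans (add_lie _ _ _)
  map_smul' r x := LinearMap.ext fun w => Subtype.ext <|
    (congrArg (⁅·, (w : N)⁆) (elt_smul r x 0)).trans (smul_lie _ _ _)
  map_lie' {x y} := LinearMap.ext fun w => Subtype.ext <|
    (congrArg (⁅·, (w : N)⁆) (elt_lie_elt_zero x y 0).symm).trans (lie_lie _ _ _)

lemma exists_lieModule {M : Type*} [AddCommGroup M] [Module ℂ M] (f : M ≃ₗ[ℂ] W) :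
    ∃ (_ : LieRingModule 𝔤 M) (_ : LieModule ℂ 𝔤 M),
      ∀ (x : 𝔤) (v : M), (f ⁅x, v⁆ : N) = ⁅(elt x 0 : ToroidalAlgebra n 𝔤), (f v : N)⁆ := by
  let ρ : 𝔤 →ₗ⁅ℂ⁆ Module.End ℂ M := (f.symm.lieConj : Module.End ℂ W →ₗ⁅ℂ⁆ _).comp hW.toEnd
  refine ⟨LieRingModule.compLieHom M ρ, LieModule.compLieHom M ρ, fun x v => ?_⟩
  exact congrArg Subtype.val (f.apply_symm_apply (hW.toEnd x (f v)))

end IsEvaluationSubspace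

end ToroidalAlgebra

end EvaluationSubspace

lemma exists_killingForm_ne_zero (K L : Type*) [Field K] [LieRing L] [LieAlgebra K L]
    [LieAlgebra.IsKilling K L] [Nontrivial L] : ∃ x y : L, killingForm K L x y ≠ 0 := by
  obtain ⟨x, hx⟩ := exists_ne (0 : L)
  by_contra! h
  exact hx ((LieAlgebra.IsKilling.killingForm_nondegenerate K L).1 x (h x))

section Generator

namespace ToroidalAlgebra

open Toroidal UniversalEnvelopingAlgebra EnvelopingAlgebra

variable {n : ℕ} {𝔤 : Type*} [LieRing 𝔤] [LieAlgebra ℂ 𝔤] {𝔥 : LieSubalgebra ℂ 𝔤} [IsLieAbelian 𝔥]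
  {N : Type*} [AddCommGroup N] [Module ℂ N]

attribute [local instance] LieRing.ofAssociativeRing

lemma inclU_injective : Function.Injective (inclU n 𝔥) := by
  have : ⇑(inclU n 𝔥) = tensorEquiv n 𝔥 ∘ Algebra.TensorProduct.includeLeft (S := ℂ) :=
    funext fun v => by simp [tensorEquiv_tmul]
  rw [this]
  exact (tensorEquiv n 𝔥).injective.comp
    (Algebra.TensorProduct.includeLeft_injective (algebraMap ℂ (PD n)).injective)

/-- The subspace `U(𝔥) e⁻¹(1)` of a module that is free of rank one over `U(𝔥̃ₙ)`. -/
def generatorSpace (e : N ≃ₗ[ℂ] UniversalEnvelopingAlgebra ℂ (cartan n 𝔥)) : Submodule ℂ N :=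
  (Subalgebra.toSubmodule (inclU n 𝔥).range).comap e.toLinearMap

/-- The identification of `U(𝔥)` with `U(𝔥) e⁻¹(1)`. -/
def generatorSpaceEquiv (e : N ≃ₗ[ℂ] UniversalEnvelopingAlgebra ℂ (cartan n 𝔥)) :
    UniversalEnvelopingAlgebra ℂ 𝔥 ≃ₗ[ℂ] generatorSpace e :=
  LinearEquiv.ofBijective
    ((e.symm.toLinearMap ∘ₗ (inclU n 𝔥).toLinearMap).codRestrict (generatorSpace e)
      fun v => ⟨v, (e.apply_symm_apply _).symm⟩)
    ⟨fun _ _ h => inclU_injective (e.symm.injective (congrArg Subtype.val h)),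
    fun ⟨_, v, hv⟩ => ⟨v, Subtype.ext (e.symm_apply_eq.2 hv)⟩⟩

lemma symm_one_mem_generatorSpace (e : N ≃ₗ[ℂ] UniversalEnvelopingAlgebra ℂ (cartan n 𝔥)) :
    e.symm 1 ∈ generatorSpace e :=
  ⟨1, (map_one _).trans (e.apply_symm_apply 1).symm⟩

variable [LieRingModule (ToroidalAlgebra n 𝔤) N] [LieModule ℂ (ToroidalAlgebra n 𝔤) N]
  {e : N ≃ₗ[ℂ] UniversalEnvelopingAlgebra ℂ (cartan n 𝔥)}
  (he : ∀ u v, e (act (cartan n 𝔥) N u v) = u * e v)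
include he

section Weight

variable {α : Module.Dual ℂ 𝔥} {x : 𝔤} (hx : ∀ k : 𝔥, ⁅(k : 𝔤), x⁆ = α k • x)
include hx

lemma elt_zero_lie_mem_generatorSpace (mem : symbol e (elt x 0) ∈ (inclU n 𝔥).range) :
    ∀ w ∈ generatorSpace e, ⁅(elt x 0 : ToroidalAlgebra n 𝔤), w⁆ ∈ generatorSpace e := by
  rintro _ ⟨v, hv⟩
  change e _ ∈ (inclU n 𝔥).range
  rw [apply_lie_eq_weightShift_mul_symbol he (coe_cartan_lie_elt hx 0)]
  refine mul_mem ⟨weightShift α v, ?_⟩ mem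
  exact (weightShift_weight_inclU α 0 v).symm.trans (congrArg _ hv)

lemma elt_lie_eq_monoVal_smul {lam : Fin n → ℂˣ}
    (symbol_eq : ∀ a, symbol e (elt x a) = (monoVal lam a : ℂ) • symbol e (elt x 0))
    (a : Fin n → ℤ) :
    ∀ w ∈ generatorSpace e, ⁅(elt x a : ToroidalAlgebra n 𝔤), w⁆
      = (monoVal lam a : ℂ) • ⁅(elt x 0 : ToroidalAlgebra n 𝔤), w⁆ := by
  rintro w ⟨v, hv⟩
  refine e.injective ?_
  have hv : e w = inclU n 𝔥 v := hv.symm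
  rw [map_smul, apply_lie_eq_weightShift_mul_symbol he (coe_cartan_lie_elt hx a),
    apply_lie_eq_weightShift_mul_symbol he (coe_cartan_lie_elt hx 0), hv,
    weightShift_weight_inclU, weightShift_weight_inclU, symbol_eq, mul_smul_comm]

end Weight

theorem exists_isEvaluationSubspace_generatorSpace [FiniteDimensional ℂ 𝔤]
    [LieAlgebra.IsSimple ℂ 𝔤] {ι : Type*} [Finite ι] (b : LieAlgebra.Basis ι 𝔥) :
    ∃ lam : Fin n → ℂˣ, IsEvaluationSubspace lam 𝔤 (generatorSpace e) := by
  cases nonempty_fintype ι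
  have lie_e (i : ι) (k : 𝔥) : ⁅(k : 𝔤), b.e i⁆ = b.baseSupp i k • b.e i :=
    (b.baseSupp_apply_smul_e i k).symm
  have lie_f (i : ι) (k : 𝔥) : ⁅(k : 𝔤), b.f i⁆ = -b.baseSupp i k • b.f i := by
    rw [neg_smul, b.baseSupp_apply_smul_f, neg_neg]
    rfl
  have rank_one (i : ι) :=
    exists_symbol_elt_eq_monoVal_smul he (h := b.h' i) (b.sl2 i) (lie_e i) (lie_f i)
  have lie_mem (x : 𝔤) :
      ∀ w ∈ generatorSpace e, ⁅(elt x 0 : ToroidalAlgebra n 𝔤), w⁆ ∈ generatorSpace e := by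
    refine elt_zero_lie_mem_of_lieSpan_eq_top b.span_ef ?_ x
    rintro _ (⟨i, rfl⟩ | ⟨i, rfl⟩)
    · exact elt_zero_lie_mem_generatorSpace he (lie_e i) (rank_one i).1
    · exact elt_zero_lie_mem_generatorSpace he (α := -b.baseSupp i) (lie_f i) (rank_one i).2.1
  obtain ⟨i⟩ : Nonempty ι := by
    by_contra! h
    have := LieAlgebra.IsSimple.nontrivial ℂ 𝔤
    have span := b.span_ef
    rw [Set.range_eq_empty, Set.range_eq_empty, Set.empty_union, LieSubalgebra.span_empty] at span
    obtain ⟨x, hx⟩ := exists_ne (0 : 𝔤)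
    exact hx ((LieSubalgebra.mem_bot x).1 (span ▸ LieSubalgebra.mem_top x))
  obtain ⟨lam, symbol_eq⟩ := (rank_one i).2.2
  exact ⟨lam, isEvaluationSubspace_of_ne_zero lie_mem (b.sl2 i).e_ne_zero
    (elt_lie_eq_monoVal_smul he (lie_e i) symbol_eq)⟩

end ToroidalAlgebra

end Generator

lemma IsFreeRankOne.of_equiv {𝔞 : Type*} [LieRing 𝔞] [LieAlgebra ℂ 𝔞] {𝔟 : LieSubalgebra ℂ 𝔞}
    {N N' : Type*} [AddCommGroup N] [Module ℂ N] [LieRingModule 𝔞 N] [LieModule ℂ 𝔞 N]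
    [AddCommGroup N'] [Module ℂ N'] [LieRingModule 𝔞 N'] [LieModule ℂ 𝔞 N']
    (φ : N ≃ₗ⁅ℂ,𝔞⁆ N') (h : IsFreeRankOne 𝔟 N') : IsFreeRankOne 𝔟 N := by
  obtain ⟨e, he⟩ := h
  refine ⟨φ.toLinearEquiv.trans e,
    EnvelopingAlgebra.apply_act_eq_mul (e.toLinearMap ∘ₗ φ.toLinearEquiv.toLinearMap) fun x v => ?_⟩
  rw [LinearMap.comp_apply, LinearMap.comp_apply]
  change e (φ ⁅(x : 𝔞), v⁆) = _ * e (φ v)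
  rw [← he, UniversalEnvelopingAlgebra.lift_ι_apply]
  exact congrArg e (φ.map_lie x v)

namespace TildeModule

open Toroidal ToroidalAlgebra

variable {n : ℕ} {𝔤 : Type*} [LieRing 𝔤] [LieAlgebra ℂ 𝔤] {lam : Fin n → ℂˣ}
  {M : Type*} [AddCommGroup M] [Module ℂ M] [LieRingModule 𝔤 M] [LieModule ℂ 𝔤 M]
  {N : Type*} [AddCommGroup N] [Module ℂ N] [LieRingModule (ToroidalAlgebra n 𝔤) N]
  [LieModule ℂ (ToroidalAlgebra n 𝔤) N]

attribute [local instance] LieRing.ofAssociativeRing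

lemma map_lie_of_generators (L : TildeModule lam M →ₗ[ℂ] N)
    (map_elt : ∀ (x : 𝔤) a v p, L ⁅(elt x a : ToroidalAlgebra n 𝔤), mk lam M v p⁆
      = ⁅(elt x a : ToroidalAlgebra n 𝔤), L (mk lam M v p)⁆)
    (central_map : ∀ a j v p, ⁅(central a j : ToroidalAlgebra n 𝔤), L (mk lam M v p)⁆ = 0)
    (map_der : ∀ i v p, L (mk lam M v (MvPolynomial.X i * p))
      = ⁅(der i : ToroidalAlgebra n 𝔤), L (mk lam M v p)⁆)
    (u : ToroidalAlgebra n 𝔤) (t : TildeModule lam M) : L ⁅u, t⁆ = ⁅u, L t⁆ := by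
  have : L.compRight ℂ ∘ₗ (LieModule.toEnd ℂ (ToroidalAlgebra n 𝔤) (TildeModule lam M)).toLinearMap
      = L.lcomp ℂ N ∘ₗ (LieModule.toEnd ℂ (ToroidalAlgebra n 𝔤) N).toLinearMap := by
    refine ToroidalAlgebra.linearMap_ext (fun x a => TildeModule.linearMap_ext (map_elt x a))
      (fun a j => TildeModule.linearMap_ext fun v p => ?_)
      fun i => TildeModule.linearMap_ext fun v p => ?_
    · change L ⁅(central a j : ToroidalAlgebra n 𝔤), _⁆ = ⁅(central a j : ToroidalAlgebra n 𝔤), L _⁆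
      rw [central_map, central_lie, map_zero]
    · change L ⁅(der i : ToroidalAlgebra n 𝔤), _⁆ = ⁅(der i : ToroidalAlgebra n 𝔤), L _⁆
      rw [← map_der, der_lie_mk]
  exact LinearMap.congr_fun₂ this u t

end TildeModule

namespace ToroidalAlgebra

open Toroidal UniversalEnvelopingAlgebra EnvelopingAlgebra

variable {n : ℕ} {𝔤 : Type*} [LieRing 𝔤] [LieAlgebra ℂ 𝔤] {𝔥 : LieSubalgebra ℂ 𝔤} [IsLieAbelian 𝔥]
  {N : Type*} [AddCommGroup N] [Module ℂ N] [LieRingModule (ToroidalAlgebra n 𝔤) N]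
  [LieModule ℂ (ToroidalAlgebra n 𝔤) N]

lemma central_lie_act {w : N} {m : Fin n → ℤ} {j : Fin n}
    (h : ⁅(central m j : ToroidalAlgebra n 𝔤), w⁆ = 0)
    (u : UniversalEnvelopingAlgebra ℂ (cartan n 𝔥)) :
    ⁅(central m j : ToroidalAlgebra n 𝔤), act (cartan n 𝔥) N u w⁆ = 0 := by
  rw [lie_act (χ := weight (0 : Module.Dual ℂ 𝔥) m) (fun y => ?_), h, map_zero]
  obtain ⟨p, rfl⟩ := (cartanEquiv n 𝔥).surjective y
  rw [weight_cartanEquiv, coe_cartanEquiv]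
  ext1 <;> simp [elt, ofDeg, central, degLoop_zero, degK_zero, degK_tK]

lemma act_inclPD_X (i : Fin n) (v : N) :
    act (cartan n 𝔥) N (inclPD n 𝔥 (MvPolynomial.X i)) v = ⁅(der i : ToroidalAlgebra n 𝔤), v⁆ := by
  rw [inclPD_X, act_ι, coe_cartanEquiv]
  exact congrArg (⁅·, v⁆) ((congrArg (· + _) (elt_zero 0)).trans (zero_add _))

lemma elt_lie_act_inclPD (x : 𝔤) (a : Fin n → ℤ) (p : PD n) (v : N) :
    ⁅(elt x a : ToroidalAlgebra n 𝔤), act (cartan n 𝔥) N (inclPD n 𝔥 p) v⁆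
      = act (cartan n 𝔥) N (inclPD n 𝔥 (shift a p)) ⁅(elt x a : ToroidalAlgebra n 𝔤), v⁆ := by
  induction p using MvPolynomial.induction_on generalizing v with
  | C r =>
    simp only [← MvPolynomial.algebraMap_eq, AlgHom.commutes, Module.algebraMap_end_apply, lie_smul]
  | add p q hp hq => simp only [map_add, LinearMap.add_apply, lie_add, hp, hq]
  | mul_X p i hp =>
    simp only [map_mul, Module.End.mul_apply, hp, act_inclPD_X]
    rw [leibniz_lie, ← lie_skew, der_lie_elt, shift_X, map_sub, map_sub, LinearMap.sub_apply,
      act_inclPD_X, ← MvPolynomial.algebraMap_eq, AlgHom.commutes, AlgHom.commutes,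
      Module.algebraMap_end_apply, neg_lie, smul_lie, neg_add_eq_sub]

attribute [local instance] LieRing.ofAssociativeRing

variable {e : N ≃ₗ[ℂ] UniversalEnvelopingAlgebra ℂ (cartan n 𝔥)}
  (he : ∀ u v, e (act (cartan n 𝔥) N u v) = u * e v)
include he

lemma symm_mul (u v : UniversalEnvelopingAlgebra ℂ (cartan n 𝔥)) :
    e.symm (u * v) = act (cartan n 𝔥) N u (e.symm v) :=
  e.symm_apply_eq.2 (by rw [he, e.apply_symm_apply])

variable {M : Type*} [AddCommGroup M] [Module ℂ M] [LieRingModule 𝔤 M] [LieModule ℂ 𝔤 M]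
  {f : M ≃ₗ[ℂ] UniversalEnvelopingAlgebra ℂ 𝔥}
  (hf : ∀ (x : 𝔤) (v : M), e.symm (inclU n 𝔥 (f ⁅x, v⁆))
    = ⁅(elt x 0 : ToroidalAlgebra n 𝔤), e.symm (inclU n 𝔥 (f v))⁆)
include hf

lemma isFreeRankOne_of_symm_inclU : IsFreeRankOne 𝔥 M := by
  refine ⟨f, apply_act_eq_mul f.toLinearMap fun h v => inclU_injective (n := n) ?_⟩
  have coe : (cartanEquiv n 𝔥 (h, 0) : ToroidalAlgebra n 𝔤) = elt (h : 𝔤) 0 := by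
    rw [coe_cartanEquiv, map_zero, add_zero]
  refine e.symm.injective ?_
  rw [LinearEquiv.coe_coe, hf, map_mul, inclU_ι, symm_mul he, act_ι, coe]

lemma nonempty_equiv_tildeModule {lam : Fin n → ℂˣ}
    (hW : IsEvaluationSubspace lam 𝔤 (generatorSpace e))
    (central_lie : ∀ m j, ⁅(central m j : ToroidalAlgebra n 𝔤), e.symm 1⁆ = 0) :
    Nonempty (N ≃ₗ⁅ℂ, ToroidalAlgebra n 𝔤⁆ TildeModule lam M) := by
  let L : TildeModule lam M ≃ₗ[ℂ] N :=
    (TensorProduct.congr f (LinearEquiv.refl ℂ (PD n))).trans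
      ((tensorEquiv n 𝔥).toLinearEquiv.trans e.symm)
  have L_mk (v : M) (p : PD n) : L (TildeModule.mk lam M v p)
      = act (cartan n 𝔥) N (inclPD n 𝔥 p) (e.symm (inclU n 𝔥 (f v))) := by
    rw [← symm_mul he, mul_comm]
    rfl
  have map_lie := TildeModule.map_lie_of_generators (𝔤 := 𝔤) L.toLinearMap ?_ ?_ ?_
  · exact ⟨LieModuleEquiv.symm { L with map_lie' := fun {u t} => map_lie u t }⟩
  · intro x a v p
    have mem : e.symm (inclU n 𝔥 (f v)) ∈ generatorSpace e := (generatorSpaceEquiv e (f v)).2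
    rw [TildeModule.elt_lie_mk, map_smul, LinearEquiv.coe_coe, L_mk, L_mk, elt_lie_act_inclPD,
      hW.elt_lie x a _ mem, map_smul, hf]
  · intro m j v p
    have := central_lie_act (central_lie m j) (inclPD n 𝔥 p * inclU n 𝔥 (f v))
    rwa [map_mul, Module.End.mul_apply, ← symm_mul he, mul_one, ← L_mk] at this
  · intro i v p
    rw [LinearEquiv.coe_coe, L_mk, L_mk, map_mul, map_mul, Module.End.mul_apply, act_inclPD_X]

end ToroidalAlgebra

theorem theorem4_general {𝔤 : Type u} [LieRing 𝔤] [LieAlgebra ℂ 𝔤] [FiniteDimensional ℂ 𝔤]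
    [LieAlgebra.IsSimple ℂ 𝔤] {𝔥 : LieSubalgebra ℂ 𝔤} {ι : Type*} [Finite ι]
    (b : LieAlgebra.Basis ι 𝔥) (n : ℕ)
    (N : Type v) [AddCommGroup N] [Module ℂ N] [LieRingModule (ToroidalAlgebra n 𝔤) N]
    [LieModule ℂ (ToroidalAlgebra n 𝔤) N] :
    IsFreeRankOne (ToroidalAlgebra.cartan n 𝔥) N ↔
      ∃ (lam : Fin n → ℂˣ) (M : Type u) (_ : AddCommGroup M) (_ : Module ℂ M)
        (_ : LieRingModule 𝔤 M) (_ : LieModule ℂ 𝔤 M),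
        IsFreeRankOne 𝔥 M ∧
          Nonempty (N ≃ₗ⁅ℂ, ToroidalAlgebra n 𝔤⁆ TildeModule lam M) := by
  have := b.isLieAbelian_cartan
  constructor
  · rintro ⟨e, he⟩
    obtain ⟨lam, hW⟩ := ToroidalAlgebra.exists_isEvaluationSubspace_generatorSpace he b
    have := LieAlgebra.IsSimple.nontrivial ℂ 𝔤
    obtain ⟨x, y, hxy⟩ := exists_killingForm_ne_zero ℂ 𝔤
    have central_lie m j : ⁅(ToroidalAlgebra.central m j : ToroidalAlgebra n 𝔤), e.symm 1⁆ = 0 :=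
      hW.central_lie_eq_zero hxy m j (ToroidalAlgebra.symm_one_mem_generatorSpace e)
    obtain ⟨_, _, hf⟩ := hW.exists_lieModule (ToroidalAlgebra.generatorSpaceEquiv e)
    exact ⟨lam, UniversalEnvelopingAlgebra ℂ 𝔥, inferInstance, inferInstance, _, _,
      ToroidalAlgebra.isFreeRankOne_of_symm_inclU (f := LinearEquiv.refl ℂ _) he hf,
      ToroidalAlgebra.nonempty_equiv_tildeModule (f := LinearEquiv.refl ℂ _) he hf hW central_lie⟩
  · rintro ⟨lam, M, _, _, _, _, hM, ⟨φ⟩⟩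
    exact (TildeModule.isFreeRankOne lam M hM).of_equiv φ

end

theorem theorem4 {𝔤 : Type u} [LieRing 𝔤] [LieAlgebra ℂ 𝔤] [FiniteDimensional ℂ 𝔤]
    [LieAlgebra.IsSimple ℂ 𝔤] (𝔥 : LieSubalgebra ℂ 𝔤) (l : ℕ)
    (b : LieAlgebra.Basis (Fin l) 𝔥)
    (htype : (1 ≤ l ∧ b.A = CartanMatrix.A l) ∨ (2 ≤ l ∧ b.A = CartanMatrix.C l))
    (n : ℕ)
    (N : Type v) [AddCommGroup N] [Module ℂ N] [LieRingModule (ToroidalAlgebra n 𝔤) N]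
    [LieModule ℂ (ToroidalAlgebra n 𝔤) N] :
    IsFreeRankOne (ToroidalAlgebra.cartan n 𝔥) N ↔
      ∃ (lam : Fin n → ℂˣ) (M : Type u) (_ : AddCommGroup M) (_ : Module ℂ M)
        (_ : LieRingModule 𝔤 M) (_ : LieModule ℂ 𝔤 M),
        IsFreeRankOne 𝔥 M ∧
          Nonempty (N ≃ₗ⁅ℂ, ToroidalAlgebra n 𝔤⁆ TildeModule lam M) :=
  theorem4_general b n N
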